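/- For $k\in\mathbb{R}$ and $n\ge 1$ let $M_k^n$ be the model space of constant curvature $k$: for $k>0$ the unit sphere $\mathbb{S}^n\subset\mathbb{R}^{n+1}$ with the spherical distance multiplied by $1/\sqrt{k}$, for $k=0$ the Euclidean space $\mathbb{R}^n$, for $k<0$ the hyperbolic space $\mathbb{H}^n$ (hyperboloid model) with the hyperbolic distance multiplied by $1/\sqrt{-k}$. Put $D_k=\pi/\sqrt{k}$ if $k>0$ and $D_k=\infty$ if $k\le 0$. A geodesic line in $M_k^n$ is a subset isometric to $\mathbb{R}$ if $k\le 0$ and a great circle if $k>0$. In a metric space, a set is convex if it contains every geodesic segment joining two of its points, and $P_C(x)$ is the set of points of $C$ at distance $\mathrm{dist}(x,C)=\inf_{y\in C}d(x,y)$ from $x$ (identified with its element if it is a singleton). For a nonempty closed convex $C\subseteq M_k^n$, a point $z\in M_k^n$ is the reflection $R_Cx$ of $x\in M_k^n$ in $C$ if $P_C(x)$ is a singleton, $z$ lies on a geodesic line containing a geodesic segment $[x,P_Cx]$, and $d(x,P_Cx)=d(z,P_Cx)=\tfrac12 d(x,z)$. Let $k\neq k'$ be real numbers, let $n,m\ge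 1$ be integers, and let $(X,d)$ be the gluing of $M_k^n$ and $M_{k'}^m$ through a point $\theta$ (an arbitrary point of $M_k^n$ is identified with an arbitrary point of $M_{k'}^m$, and $d(x,y)=d(x,\theta)+d(\theta,y)$ for $x\in M_k^n$, $y\in M_{k'}^m$). Let $B\subseteq X$ be nonempty, closed and convex, and let $U=\{x\in X:\mathrm{dist}(x,B)<\min\{D_k,D_{k'}\}/2\}$. If $\theta\notin B$, then $B$ is strictly contained in exactly one of the two model spaces. For $x\in U$ define $R_Bx$ as follows. (1) If $\theta\in B$, then $R_Bx=R_{B\cap M}x$, where $M\in\{M_k^n,M_{k'}^m\}$ is the model space that contains $x$ and the reflection is taken inside $M$. (2) If $\theta\notin B$ and $M$ is the model space that contains $B$, then (2.1) if $x\in M$, $R_Bx$ is the reflection of $x$ in $B$ inside $M$; (2.2) if $x$ lies in the other model space, $R_Bx$ is the point of the geodesic line in $M$ containing $[\theta,P_B\theta]$ such that $d(P_B\theta,R_Bx)=d(x,P_B\theta)$ and $d(R_Bx,\theta)>d(R_Bx,P_B\theta)$. Then for every $x\in U$ there is exactly one point $R_Bx$ with these properties (at $x=\theta$, which lies in both model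 spaces, the applicable clauses give the same point), and $R_B$ is nonexpansive on $U$: $$d(R_Bx,R_By)\le d(x,y)\qquad\text{for all }x,y\in U.$$ -/

import Mathlib

/-! ### Model spaces of constant curvature -/

/-- The underlying set of the model space `M_k^n`. A point of `ℝ^(n+1) = ℝ^n × ℝ` is written
`(vec, height)`, so that `height` is the last coordinate. The model space is
* for `0 < k` the unit sphere of `ℝ^(n+1)`;
* for `k = 0` the Euclidean space `ℝ^n` (as the hyperplane `height = 0`);
* for `k < 0` the upper sheet of the hyperboloid `|vec|^2 - height^2 = -1`. -/
@[ext]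
structure ModelSpace (k : ℝ) (n : ℕ) where
  vec : EuclideanSpace ℝ (Fin n)
  height : ℝ
  sphere_mem : 0 < k → ‖vec‖ ^ 2 + height ^ 2 = 1
  flat_mem : k = 0 → height = 0
  hyperboloid_mem : k < 0 → ‖vec‖ ^ 2 - height ^ 2 = -1 ∧ 0 < height

namespace ModelSpace

variable {k : ℝ} {n : ℕ}

/-- The Euclidean scalar product of `ℝ^(n+1)`. -/
noncomputable def scalar (x y : ModelSpace k n) : ℝ :=
  inner ℝ x.vec y.vec + x.height * y.height

/-- The Lorentzian form of `ℝ^(n+1)`. -/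
noncomputable def lorentz (x y : ModelSpace k n) : ℝ :=
  inner ℝ x.vec y.vec - x.height * y.height

/-- The distance of `M_k^n`: the spherical distance divided by `√k`, the Euclidean distance, or the
hyperbolic distance divided by `√(-k)`. -/
noncomputable def modelDist (x y : ModelSpace k n) : ℝ :=
  if 0 < k then Real.arccos (scalar x y) / √k
  else if k = 0 then dist x.vec y.vec
  else Real.arcosh (-lorentz x y) / √(-k)

/-- The vector of `ℝ^(n+1)` given by a point, with the Euclidean inner product. -/
noncomputable def toEuclid (x : ModelSpace k n) : WithLp 2 (EuclideanSpace ℝ (Fin n) × ℝ) :=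
  WithLp.toLp 2 (x.vec, x.height)

theorem inner_toEuclid (x y : ModelSpace k n) :
    inner ℝ x.toEuclid y.toEuclid = scalar x y := by
  simp [toEuclid, scalar, WithLp.prod_inner_apply, mul_comm]

theorem scalar_self (hk : 0 < k) (x : ModelSpace k n) : scalar x x = 1 := by
  have := x.sphere_mem hk
  rw [scalar, real_inner_self_eq_norm_sq]
  linarith [sq x.height]

theorem norm_toEuclid (hk : 0 < k) (x : ModelSpace k n) : ‖x.toEuclid‖ = 1 := by
  have h : ‖x.toEuclid‖ ^ 2 = 1 := by
    rw [← real_inner_self_eq_norm_sq, inner_toEuclid, scalar_self hk]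
  nlinarith [norm_nonneg x.toEuclid]

theorem arccos_scalar (hk : 0 < k) (x y : ModelSpace k n) :
    Real.arccos (scalar x y) = InnerProductGeometry.angle x.toEuclid y.toEuclid := by
  rw [InnerProductGeometry.angle, inner_toEuclid, norm_toEuclid hk, norm_toEuclid hk]
  simp

theorem lorentz_self (hk : k < 0) (x : ModelSpace k n) : lorentz x x = -1 := by
  have := (x.hyperboloid_mem hk).1
  rw [lorentz, real_inner_self_eq_norm_sq]
  linarith [sq x.height]

theorem scalar_comm (x y : ModelSpace k n) : scalar x y = scalar y x := by
  rw [scalar, scalar, real_inner_comm, mul_comm]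

theorem lorentz_comm (x y : ModelSpace k n) : lorentz x y = lorentz y x := by
  rw [lorentz, lorentz, real_inner_comm, mul_comm]

theorem one_le_neg_lorentz (hk : k < 0) (x y : ModelSpace k n) : 1 ≤ -lorentz x y := by
  obtain ⟨hx, hx0⟩ := x.hyperboloid_mem hk
  obtain ⟨hy, hy0⟩ := y.hyperboloid_mem hk
  have hi : inner ℝ x.vec y.vec ≤ ‖x.vec‖ * ‖y.vec‖ := real_inner_le_norm _ _
  have ha := norm_nonneg x.vec
  have hb := norm_nonneg y.vec
  have h1 : 1 + ‖x.vec‖ * ‖y.vec‖ ≤ x.height * y.height := by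
    apply le_of_sq_le_sq _ (by positivity)
    have : (x.height * y.height) ^ 2 = (1 + ‖x.vec‖ ^ 2) * (1 + ‖y.vec‖ ^ 2) := by
      rw [mul_pow]
      congr 1 <;> linarith
    rw [this]
    nlinarith [sq_nonneg (‖x.vec‖ - ‖y.vec‖)]
  rw [lorentz]
  linarith

/-- The Lorentzian form is positive semidefinite on the orthogonal complement of a point of the
hyperboloid. -/
theorem lorentz_complement_nonneg {E : Type*} [NormedAddCommGroup E] [InnerProductSpace ℝ E]
    {v y : E} {t h : ℝ} (hy : ‖y‖ ^ 2 - h ^ 2 = -1) (ho : inner ℝ v y - t * h = 0) :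
    0 ≤ ‖v‖ ^ 2 - t ^ 2 := by
  have h1 : (t * h) ^ 2 ≤ (‖v‖ * ‖y‖) ^ 2 := by
    have : t * h = inner ℝ v y := by linarith
    rw [this, ← sq_abs]
    exact pow_le_pow_left₀ (abs_nonneg _) (abs_real_inner_le_norm v y) 2
  have h2 : ‖y‖ ^ 2 = h ^ 2 - 1 := by linarith
  rw [mul_pow, mul_pow, h2] at h1
  by_contra hlt
  push Not at hlt
  have h3 : 1 ≤ h ^ 2 := by nlinarith [sq_nonneg ‖y‖]
  nlinarith [sq_nonneg ‖v‖]

theorem neg_lorentz_le (hk : k < 0) (x y z : ModelSpace k n) :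
    -lorentz x z ≤ lorentz x y * lorentz y z +
      √(lorentz x y ^ 2 - 1) * √(lorentz y z ^ 2 - 1) := by
  have hxx := lorentz_self hk x
  have hyy := lorentz_self hk y
  have hzz := lorentz_self hk z
  set A := lorentz x y with hA
  set B := lorentz y z with hB
  set C := lorentz x z with hC
  have hA1 : 0 ≤ A ^ 2 - 1 := by nlinarith [one_le_neg_lorentz hk x y]
  have hB1 : 0 ≤ B ^ 2 - 1 := by nlinarith [one_le_neg_lorentz hk y z]
  -- the quadratic form on `(x + A y) + s (z + B y)` is nonnegative
  have key : ∀ s : ℝ, 0 ≤ (B ^ 2 - 1) * (s * s) + (2 * (C + A * B)) * s + (A ^ 2 - 1) := by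
    intro s
    have hyb := (y.hyperboloid_mem hk).1
    have ho : inner ℝ (x.vec + s • z.vec + (A + s * B) • y.vec) y.vec
        - (x.height + s * z.height + (A + s * B) * y.height) * y.height = 0 := by
      simp only [inner_add_left, real_inner_smul_left]
      have hzy : inner ℝ z.vec y.vec - z.height * y.height = B := by
        rw [hB, lorentz_comm]; rfl
      simp only [lorentz] at hyy hA
      linear_combination -hA + s * hzy + (A + s * B) * hyy
    have h0 := lorentz_complement_nonneg hyb ho
    have hexp : ‖x.vec + s • z.vec + (A + s * B) • y.vec‖ ^ 2 -
        (x.height + s * z.height + (A + s * B) * y.height) ^ 2 =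
        (B ^ 2 - 1) * (s * s) + (2 * (C + A * B)) * s + (A ^ 2 - 1) := by
      rw [← real_inner_self_eq_norm_sq]
      simp only [inner_add_left, inner_add_right, real_inner_smul_left, real_inner_smul_right]
      rw [real_inner_comm x.vec z.vec, real_inner_comm x.vec y.vec, real_inner_comm y.vec z.vec]
      simp only [lorentz] at hxx hyy hzz hA hB hC
      linear_combination hxx + s ^ 2 * hzz + (A + s * B) ^ 2 * hyy - 2 * s * hC
        - 2 * (A + s * B) * hA - 2 * s * (A + s * B) * hB
    linarith
  have hd := discrim_le_zero key
  rw [discrim] at hd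
  have h4 : (C + A * B) ^ 2 ≤ (A ^ 2 - 1) * (B ^ 2 - 1) := by nlinarith
  have h5 : |C + A * B| ≤ √((A ^ 2 - 1) * (B ^ 2 - 1)) := Real.abs_le_sqrt h4
  rw [Real.sqrt_mul hA1] at h5
  linarith [neg_abs_le (C + A * B)]

theorem arcosh_triangle (hk : k < 0) (x y z : ModelSpace k n) :
    Real.arcosh (-lorentz x z) ≤ Real.arcosh (-lorentz x y) + Real.arcosh (-lorentz y z) := by
  have h1 := one_le_neg_lorentz hk x y
  have h2 := one_le_neg_lorentz hk y z
  have h3 := one_le_neg_lorentz hk x z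
  have n1 := Real.arcosh_nonneg h1
  have n2 := Real.arcosh_nonneg h2
  rw [← Real.arcosh_cosh (add_nonneg n1 n2),
    Real.arcosh_le_arcosh (by linarith) (Real.cosh_pos _), Real.cosh_add,
    Real.cosh_arcosh h1, Real.cosh_arcosh h2, Real.sinh_arcosh h1, Real.sinh_arcosh h2]
  have := neg_lorentz_le hk x y z
  rw [neg_sq, neg_sq]
  linarith

theorem modelDist_self (x : ModelSpace k n) : modelDist x x = 0 := by
  unfold modelDist
  split_ifs with h1 h2
  · simp [scalar_self h1]
  · simp
  · have hk : k < 0 := lt_of_le_of_ne (not_lt.1 h1) h2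
    simp [lorentz_self hk]

theorem modelDist_comm (x y : ModelSpace k n) : modelDist x y = modelDist y x := by
  unfold modelDist
  rw [scalar_comm, lorentz_comm, dist_comm]

theorem modelDist_triangle (x y z : ModelSpace k n) :
    modelDist x z ≤ modelDist x y + modelDist y z := by
  unfold modelDist
  split_ifs with h1 h2
  · rw [← add_div]
    gcongr
    rw [arccos_scalar h1, arccos_scalar h1, arccos_scalar h1]
    exact InnerProductGeometry.angle_le_angle_add_angle _ _ _
  · exact dist_triangle _ _ _
  · have hk : k < 0 := lt_of_le_of_ne (not_lt.1 h1) h2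
    rw [← add_div]
    gcongr
    exact arcosh_triangle hk x y z

theorem eq_of_modelDist_eq_zero {x y : ModelSpace k n} (h : modelDist x y = 0) : x = y := by
  unfold modelDist at h
  split_ifs at h with h1 h2
  · have hs : √k ≠ 0 := (Real.sqrt_pos.2 h1).ne'
    rw [div_eq_zero_iff, or_iff_left hs, Real.arccos_eq_zero] at h
    have hx := norm_toEuclid h1 x
    have hy := norm_toEuclid h1 y
    have hle : inner ℝ x.toEuclid y.toEuclid ≤ 1 := by
      simpa [hx, hy] using real_inner_le_norm x.toEuclid y.toEuclid
    have he : x.toEuclid = y.toEuclid := by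
      rw [← inner_eq_one_iff_of_norm_eq_one (𝕜 := ℝ) hx hy]
      exact le_antisymm hle (by rw [inner_toEuclid]; exact h)
    have he' := congrArg WithLp.ofLp he
    simp only [toEuclid, Prod.mk.injEq] at he'
    exact ModelSpace.ext he'.1 he'.2
  · exact ModelSpace.ext (dist_eq_zero.1 h) (by rw [x.flat_mem h2, y.flat_mem h2])
  · have hk : k < 0 := lt_of_le_of_ne (not_lt.1 h1) h2
    have hs : √(-k) ≠ 0 := (Real.sqrt_pos.2 (by linarith)).ne'
    rw [div_eq_zero_iff, or_iff_left hs, Real.arcosh_eq_zero_iff (one_le_neg_lorentz hk x y)] at h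
    obtain ⟨hx, hx0⟩ := x.hyperboloid_mem hk
    obtain ⟨hy, hy0⟩ := y.hyperboloid_mem hk
    have hi : inner ℝ x.vec y.vec ≤ ‖x.vec‖ * ‖y.vec‖ := real_inner_le_norm _ _
    have ha := norm_nonneg x.vec
    have hb := norm_nonneg y.vec
    rw [lorentz] at h
    have hle : x.height * y.height ≤ 1 + ‖x.vec‖ * ‖y.vec‖ := by linarith
    have hsq : (x.height * y.height) ^ 2 ≤ (1 + ‖x.vec‖ * ‖y.vec‖) ^ 2 :=
      pow_le_pow_left₀ (by positivity) hle 2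
    have hprod : (x.height * y.height) ^ 2 = (1 + ‖x.vec‖ ^ 2) * (1 + ‖y.vec‖ ^ 2) := by
      rw [mul_pow]
      congr 1 <;> linarith
    have hn : ‖x.vec‖ = ‖y.vec‖ := by
      have : (‖x.vec‖ - ‖y.vec‖) ^ 2 ≤ 0 := by nlinarith
      nlinarith [sq_nonneg (‖x.vec‖ - ‖y.vec‖)]
    have hh : x.height = y.height := by
      have : x.height ^ 2 = y.height ^ 2 := by
        rw [hn] at hx
        linarith
      exact (sq_eq_sq₀ hx0.le hy0.le).1 this
    refine ModelSpace.ext ?_ hh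
    have h0 : ‖x.vec - y.vec‖ ^ 2 = 0 := by
      rw [norm_sub_sq_real]
      have : inner ℝ x.vec y.vec = y.height ^ 2 - 1 := by rw [hh] at h; linarith
      rw [this, hn]
      linarith
    exact sub_eq_zero.1 (norm_eq_zero.1 (pow_eq_zero_iff (by norm_num) |>.1 h0))

noncomputable instance : MetricSpace (ModelSpace k n) where
  dist := modelDist
  dist_self := modelDist_self
  dist_comm := modelDist_comm
  dist_triangle := modelDist_triangle
  eq_of_dist_eq_zero := eq_of_modelDist_eq_zero

end ModelSpace

/-- The number `D_k`: it is `π / √k` for `0 < k` and `∞` for `k ≤ 0`. -/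
noncomputable def modelDiam (k : ℝ) : ENNReal :=
  if 0 < k then ENNReal.ofReal (Real.pi / √k) else ⊤

/-! ### Geodesics, convexity, projections -/

/-- `c`, restricted to `[0, l]`, is a geodesic from `x` to `y`. -/
def IsGeodesic {X : Type*} [MetricSpace X] (c : ℝ → X) (l : ℝ) (x y : X) : Prop :=
  0 ≤ l ∧ c 0 = x ∧ c l = y ∧
    ∀ s ∈ Set.Icc 0 l, ∀ t ∈ Set.Icc 0 l, dist (c s) (c t) = |s - t|

/-- `S` is a geodesic segment joining `x` and `y`. -/
def IsGeodesicSegment {X : Type*} [MetricSpace X] (S : Set X) (x y : X) : Prop :=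
  ∃ (c : ℝ → X) (l : ℝ), IsGeodesic c l x y ∧ S = c '' Set.Icc 0 l

/-- A set is convex if it contains every geodesic segment joining two of its points. -/
def IsGeodesicallyConvex {X : Type*} [MetricSpace X] (C : Set X) : Prop :=
  ∀ x ∈ C, ∀ y ∈ C, ∀ S : Set X, IsGeodesicSegment S x y → S ⊆ C

/-- The (set-valued) metric projection onto `C`. -/
def metricProj {X : Type*} [MetricSpace X] (C : Set X) (z : X) : Set X :=
  {y | y ∈ C ∧ dist z y = Metric.infDist z C}

/-- Geodesic lines of `M_k^n`. For `k ≤ 0` these are the subsets isometric to `ℝ`; for `0 < k`,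
where `M_k^n` has diameter `D_k`, they are the great circles, that is, the images of the curves
all of whose subarcs of length at most `D_k` are geodesics. -/
def ModelSpace.IsGeodesicLine {k : ℝ} {n : ℕ} (L : Set (ModelSpace k n)) : Prop :=
  ∃ c : ℝ → ModelSpace k n, Set.range c = L ∧
    ∀ s t : ℝ, ENNReal.ofReal |s - t| ≤ modelDiam k → dist (c s) (c t) = |s - t|

/-- `z` is the reflection of `x` with respect to `C` in `M_k^n`: the metric projection of `x` onto
`C` is a single point `p`, the point `z` lies on a geodesic line containing a geodesic segment
`[x, p]`, and `p = (x + z) / 2`. -/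
def ModelSpace.IsReflection {k : ℝ} {n : ℕ} (C : Set (ModelSpace k n)) (x z : ModelSpace k n) :
    Prop :=
  ∃ p, metricProj C x = {p} ∧
    (∃ S L, IsGeodesicSegment S x p ∧ ModelSpace.IsGeodesicLine L ∧ S ⊆ L ∧ z ∈ L) ∧
    dist x p = (1 / 2) * dist x z ∧ dist z p = (1 / 2) * dist x z

/-! ### Gluing of two model spaces through a point -/

theorem isometry_point {M : Type*} [MetricSpace M] (a : M) : Isometry (fun _ : Unit => a) :=
  isometry_subsingleton

/-- The gluing of `M_k^n` and `M_{k'}^m` obtained by identifying `a` with `b`. -/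
abbrev PointGluing {k k' : ℝ} {n m : ℕ} (a : ModelSpace k n) (b : ModelSpace k' m) : Type :=
  Metric.GlueSpace (isometry_point a) (isometry_point b)

namespace PointGluing

variable {k k' : ℝ} {n m : ℕ}

/-- The inclusion of `M_k^n` in the gluing. -/
noncomputable def inL (a : ModelSpace k n) (b : ModelSpace k' m) : ModelSpace k n → PointGluing a b :=
  Metric.toGlueL (isometry_point a) (isometry_point b)

/-- The inclusion of `M_{k'}^m` in the gluing. -/
noncomputable def inR (a : ModelSpace k n) (b : ModelSpace k' m) : ModelSpace k' m → PointGluing a b :=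
  Metric.toGlueR (isometry_point a) (isometry_point b)

/-- The gluing point `θ`. -/
noncomputable def theta (a : ModelSpace k n) (b : ModelSpace k' m) : PointGluing a b := inL a b a

/-- `z` is the reflection of `x` with respect to `B ∩ M`, computed inside the model space `M`,
which is embedded in `X` by `ι`. -/
def ReflectInside {X : Type*} (ι : ModelSpace k n → X) (B : Set X) (x z : X) : Prop :=
  ∃ u w, ι u = x ∧ ι w = z ∧ ModelSpace.IsReflection (ι ⁻¹' B) u w

/-- The reflection of a point `x` of the other model space, when `B` lies in the model space `M`
embedded in `X` by `ι`, and `M` contains the gluing point `ι a`, which is not in `B`: the metric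
projection of the gluing point onto `B` is a single point `p`, and `z` is a point of a geodesic line
in `M` containing `[ι a, p]` such that `d(p, z) = d(x, p)` and `d(z, ι a) > d(z, p)`. -/
def ReflectAcross {X : Type*} [MetricSpace X] (ι : ModelSpace k n → X) (a : ModelSpace k n)
    (B : Set X) (x z : X) : Prop :=
  ∃ p w, metricProj B (ι a) = {ι p} ∧ ι w = z ∧
    (∃ S L, IsGeodesicSegment S a p ∧ ModelSpace.IsGeodesicLine L ∧ S ⊆ L ∧ w ∈ L) ∧
    dist (ι p) z = dist x (ι p) ∧ dist z (ι a) > dist z (ι p)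

/-- `z` is the reflection of `x` with respect to `B` in the gluing. The point `θ` belongs to both
model spaces, so at `x = θ` the clauses for both model spaces are required. -/
def IsReflection (a : ModelSpace k n) (b : ModelSpace k' m) (B : Set (PointGluing a b))
    (x z : PointGluing a b) : Prop :=
  (theta a b ∈ B ∧
    (x ∈ Set.range (inL a b) → ReflectInside (inL a b) B x z) ∧
    (x ∈ Set.range (inR a b) → ReflectInside (inR a b) B x z)) ∨
  (theta a b ∉ B ∧ B ⊆ Set.range (inL a b) ∧
    (x ∈ Set.range (inL a b) → ReflectInside (inL a b) B x z) ∧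
    (x ∈ Set.range (inR a b) → ReflectAcross (inL a b) a B x z)) ∨
  (theta a b ∉ B ∧ B ⊆ Set.range (inR a b) ∧
    (x ∈ Set.range (inR a b) → ReflectInside (inR a b) B x z) ∧
    (x ∈ Set.range (inL a b) → ReflectAcross (inR a b) b B x z))

end PointGluing

/-! All three signs of curvature are treated at once through the generalized versine `genVer`,
written V, with its derivative S and second derivative C. V is strictly increasing on the range of
distances, so distances may be compared through V. Along a unit-speed line c, the function V(d(q, c
t)) solves f'' = 1 - k f, hence equals V(t) + C(t) V(d(q, c 0)) + S(t) β for some β. This one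
formula replaces the law of cosines and coordinates are not needed afterwards.

Inside one model space it has two consequences. If p is the midpoint of x and z at distance h <
D_k/2 from both, then V(qx) + V(qz) = 2 V(h) + 2 C(h) V(qp) for every q
(`genVer_dist_add_of_midpoint`). If p is a nearest point to x in a convex set and q lies in the set,
then V(xp) + C(xp) V(pq) ≤ V(xq) (`genVer_dist_ge_of_mem_metricProj`), because β ≥ 0 by minimality.
A linear combination of these makes reflections nonexpansive (`IsReflection.dist_le`).

In the gluing, a convex set missing θ stays on one side, since geodesics between the sides pass
through θ. If θ lies in B, both reflections fix θ, and mixed pairs are handled by the triangle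
inequality through θ. If θ is not in B, the reflection folds the other space onto a ray that
continues [θ, Pθ] beyond Pθ and starts at Rθ, and the position on the ray is the distance to θ
(`reflectAcross_dist_eq`). This folding is 1-Lipschitz and agrees at θ with the reflection inside M,
so mixed pairs are handled by the triangle inequality through Rθ. -/

/-! ### Trigonometric functions of constant curvature -/

namespace ModelSpace

/-- The generalized versine: the solution of `f'' = 1 - k f` with `f 0 = f' 0 = 0`. -/
noncomputable def genVer (k r : ℝ) : ℝ :=
  if 0 < k then (1 - Real.cos (√k * r)) / k
  else if k = 0 then r ^ 2 / 2
  else (Real.cosh (√(-k) * r) - 1) / (-k)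

/-- The generalized sine: the derivative of the generalized versine. -/
noncomputable def genSin (k r : ℝ) : ℝ :=
  if 0 < k then Real.sin (√k * r) / √k
  else if k = 0 then r
  else Real.sinh (√(-k) * r) / √(-k)

/-- The generalized cosine: the derivative of the generalized sine. -/
noncomputable def genCos (k r : ℝ) : ℝ := 1 - k * genVer k r

variable {k : ℝ}

theorem genVer_pos_curv (hk : 0 < k) (r : ℝ) :
    genVer k r = (1 - Real.cos (√k * r)) / k := if_pos hk

theorem genVer_flat (r : ℝ) : genVer 0 r = r ^ 2 / 2 := by simp [genVer]

theorem genVer_neg_curv (hk : k < 0) (r : ℝ) :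
    genVer k r = (Real.cosh (√(-k) * r) - 1) / (-k) := by
  rw [genVer, if_neg hk.le.not_gt, if_neg hk.ne]

theorem genSin_pos_curv (hk : 0 < k) (r : ℝ) :
    genSin k r = Real.sin (√k * r) / √k := if_pos hk

theorem genSin_flat (r : ℝ) : genSin 0 r = r := by simp [genSin]

theorem genSin_neg_curv (hk : k < 0) (r : ℝ) :
    genSin k r = Real.sinh (√(-k) * r) / √(-k) := by
  rw [genSin, if_neg hk.le.not_gt, if_neg hk.ne]

theorem genCos_pos_curv (hk : 0 < k) (r : ℝ) : genCos k r = Real.cos (√k * r) := by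
  rw [genCos, genVer_pos_curv hk]
  field_simp
  ring

theorem genCos_flat (r : ℝ) : genCos 0 r = 1 := by simp [genCos]

theorem genCos_neg_curv (hk : k < 0) (r : ℝ) : genCos k r = Real.cosh (√(-k) * r) := by
  have := hk.ne
  rw [genCos, genVer_neg_curv hk]
  field_simp
  ring

theorem genVer_zero (k : ℝ) : genVer k 0 = 0 := by simp [genVer]

theorem genVer_lt_genVer {r s : ℝ} (hr : 0 ≤ r) (hrs : r < s) (hs : 0 < k → √k * s ≤ Real.pi) :
    genVer k r < genVer k s := by
  rcases lt_trichotomy k 0 with hk | rfl | hk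
  · rw [genVer_neg_curv hk, genVer_neg_curv hk]
    have h0 : 0 < √(-k) := Real.sqrt_pos.2 (by linarith)
    have := Real.cosh_strictMonoOn (Set.mem_Ici.2 (mul_nonneg h0.le hr))
      (Set.mem_Ici.2 (mul_nonneg h0.le (hr.trans hrs.le))) (mul_lt_mul_of_pos_left hrs h0)
    exact div_lt_div_of_pos_right (by linarith) (by linarith)
  · rw [genVer_flat, genVer_flat]
    nlinarith
  · rw [genVer_pos_curv hk, genVer_pos_curv hk]
    have h0 : 0 < √k := Real.sqrt_pos.2 hk
    have := Real.cos_lt_cos_of_nonneg_of_le_pi (mul_nonneg h0.le hr) (hs hk)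
      (mul_lt_mul_of_pos_left hrs h0)
    exact div_lt_div_of_pos_right (by linarith) hk

theorem genSin_pos {r : ℝ} (hr : 0 < r) (h : 0 < k → √k * r < Real.pi) : 0 < genSin k r := by
  rcases lt_trichotomy k 0 with hk | rfl | hk
  · rw [genSin_neg_curv hk]
    have h0 : 0 < √(-k) := Real.sqrt_pos.2 (by linarith)
    exact div_pos (Real.sinh_pos_iff.2 (by positivity)) h0
  · rwa [genSin_flat]
  · rw [genSin_pos_curv hk]
    have h0 : 0 < √k := Real.sqrt_pos.2 hk
    exact div_pos (Real.sin_pos_of_pos_of_lt_pi (by positivity) (h hk)) h0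

theorem genSin_nonneg {r : ℝ} (hr : 0 ≤ r) (h : 0 < k → √k * r ≤ Real.pi) : 0 ≤ genSin k r := by
  rcases lt_trichotomy k 0 with hk | rfl | hk
  · rw [genSin_neg_curv hk]
    exact div_nonneg (Real.sinh_nonneg_iff.2 (by positivity)) (by positivity)
  · rwa [genSin_flat]
  · rw [genSin_pos_curv hk]
    exact div_nonneg (Real.sin_nonneg_of_nonneg_of_le_pi (by positivity) (h hk)) (by positivity)

theorem genCos_pos {r : ℝ} (hr : 0 ≤ r) (h : 0 < k → √k * r < Real.pi / 2) : 0 < genCos k r := by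
  rcases lt_trichotomy k 0 with hk | rfl | hk
  · rw [genCos_neg_curv hk]
    exact Real.cosh_pos _
  · simp [genCos_flat]
  · rw [genCos_pos_curv hk]
    exact Real.cos_pos_of_mem_Ioo ⟨by
      have : 0 ≤ √k * r := by positivity
      linarith [Real.pi_pos], h hk⟩

theorem genCos_two_mul (k r : ℝ) : genCos k (2 * r) = 2 * genCos k r ^ 2 - 1 := by
  rcases lt_trichotomy k 0 with hk | rfl | hk
  · rw [genCos_neg_curv hk, genCos_neg_curv hk, mul_left_comm, Real.cosh_two_mul, Real.sinh_sq]
    ring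
  · norm_num [genCos_flat]
  · rw [genCos_pos_curv hk, genCos_pos_curv hk, mul_left_comm, Real.cos_two_mul]

theorem genSin_two_mul (k r : ℝ) : genSin k (2 * r) = 2 * genSin k r * genCos k r := by
  rcases lt_trichotomy k 0 with hk | rfl | hk
  · rw [genSin_neg_curv hk, genSin_neg_curv hk, genCos_neg_curv hk, mul_left_comm,
      Real.sinh_two_mul]
    ring
  · simp [genCos_flat, genSin_flat]
  · rw [genSin_pos_curv hk, genSin_pos_curv hk, genCos_pos_curv hk, mul_left_comm,
      Real.sin_two_mul]
    ring

theorem genVer_two_mul (k r : ℝ) :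
    genVer k (2 * r) = 2 * genVer k r * (1 + genCos k r) := by
  rcases eq_or_ne k 0 with rfl | hk
  · simp only [genVer_flat, genCos_flat]
    ring
  · have h := genCos_two_mul k r
    -- For nonzero k the identity is the doubling formula for C = 1 - k V, with the factor k
    -- cancelled.
    have e : k * genVer k (2 * r) = k * (2 * genVer k r * (1 + genCos k r)) := by
      simp only [genCos] at h ⊢
      linear_combination -h
    exact mul_left_cancel₀ hk e

theorem hasDerivAt_genVer_zero (k : ℝ) : HasDerivAt (genVer k) 0 0 := by
  rcases lt_trichotomy k 0 with hk | rfl | hk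
  · rw [funext (genVer_neg_curv hk)]
    have h := (((((hasDerivAt_id (0 : ℝ)).const_mul (√(-k))).cosh).sub_const 1).div_const (-k))
    simpa using h
  · rw [funext genVer_flat]
    simpa using ((hasDerivAt_id (0 : ℝ)).pow 2).div_const 2
  · rw [funext (genVer_pos_curv hk)]
    have h := (((((hasDerivAt_id (0 : ℝ)).const_mul (√k)).cos).const_sub 1).div_const k)
    simpa using h

theorem hasDerivAt_genSin_zero (k : ℝ) : HasDerivAt (genSin k) 1 0 := by
  rcases lt_trichotomy k 0 with hk | rfl | hk
  · rw [funext (genSin_neg_curv hk)]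
    have h0 : √(-k) ≠ 0 := (Real.sqrt_pos.2 (by linarith)).ne'
    have h := ((((hasDerivAt_id (0 : ℝ)).const_mul (√(-k))).sinh).div_const (√(-k)))
    simpa [h0] using h
  · rw [funext genSin_flat]
    exact hasDerivAt_id 0
  · rw [funext (genSin_pos_curv hk)]
    have h0 : √k ≠ 0 := (Real.sqrt_pos.2 hk).ne'
    have h := ((((hasDerivAt_id (0 : ℝ)).const_mul (√k)).sin).div_const (√k))
    simpa [h0] using h

theorem ofReal_le_modelDiam {r : ℝ} :
    ENNReal.ofReal r ≤ modelDiam k ↔ (0 < k → √k * r ≤ Real.pi) := by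
  unfold modelDiam
  split_ifs with hk
  · have h0 : 0 < √k := Real.sqrt_pos.2 hk
    rw [ENNReal.ofReal_le_ofReal_iff (by positivity), le_div_iff₀ h0, mul_comm]
    simp [hk]
  · simp [hk]

theorem ofReal_lt_modelDiam_div_two {r : ℝ} :
    ENNReal.ofReal r < modelDiam k / 2 ↔ (0 < k → √k * r < Real.pi / 2) := by
  unfold modelDiam
  split_ifs with hk
  · have h0 : 0 < √k := Real.sqrt_pos.2 hk
    have h2 : (2 : ENNReal) = ENNReal.ofReal 2 := by simp
    rw [h2, ← ENNReal.ofReal_div_of_pos (by norm_num),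
      ENNReal.ofReal_lt_ofReal_iff (by positivity)]
    rw [div_right_comm, lt_div_iff₀ h0, mul_comm]
    simp [hk]
  · simp [hk, ENNReal.top_div]

end ModelSpace

/-! ### Distances and lines in the model spaces -/

namespace ModelSpace

variable {k : ℝ} {n : ℕ}

theorem dist_pos_curv (hk : 0 < k) (x y : ModelSpace k n) :
    dist x y = Real.arccos (scalar x y) / √k := if_pos hk

theorem dist_flat (x y : ModelSpace 0 n) : dist x y = dist x.vec y.vec := by
  change modelDist x y = _
  simp [modelDist]

theorem dist_neg_curv (hk : k < 0) (x y : ModelSpace k n) :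
    dist x y = Real.arcosh (-lorentz x y) / √(-k) := by
  change modelDist x y = _
  rw [modelDist, if_neg hk.le.not_gt, if_neg hk.ne]

theorem abs_scalar_le_one (hk : 0 < k) (x y : ModelSpace k n) : |scalar x y| ≤ 1 := by
  have := abs_real_inner_le_norm x.toEuclid y.toEuclid
  rwa [inner_toEuclid, norm_toEuclid hk, norm_toEuclid hk, one_mul] at this

theorem sqrt_mul_dist_pos_curv (hk : 0 < k) (x y : ModelSpace k n) :
    √k * dist x y = Real.arccos (scalar x y) := by
  have h0 : √k ≠ 0 := (Real.sqrt_pos.2 hk).ne'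
  rw [dist_pos_curv hk]
  field_simp

theorem sqrt_mul_dist_neg_curv (hk : k < 0) (x y : ModelSpace k n) :
    √(-k) * dist x y = Real.arcosh (-lorentz x y) := by
  have h0 : √(-k) ≠ 0 := (Real.sqrt_pos.2 (by linarith)).ne'
  rw [dist_neg_curv hk]
  field_simp

theorem genVer_dist_pos_curv (hk : 0 < k) (x y : ModelSpace k n) :
    genVer k (dist x y) = (1 - scalar x y) / k := by
  have h := abs_le.1 (abs_scalar_le_one hk x y)
  rw [genVer_pos_curv hk, sqrt_mul_dist_pos_curv hk, Real.cos_arccos h.1 h.2]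

theorem genVer_dist_flat (x y : ModelSpace 0 n) :
    genVer 0 (dist x y) = ‖x.vec - y.vec‖ ^ 2 / 2 := by
  rw [genVer_flat, dist_flat, dist_eq_norm]

theorem genVer_dist_neg_curv (hk : k < 0) (x y : ModelSpace k n) :
    genVer k (dist x y) = (-lorentz x y - 1) / (-k) := by
  rw [genVer_neg_curv hk, sqrt_mul_dist_neg_curv hk, Real.cosh_arcosh (one_le_neg_lorentz hk x y)]

theorem sqrt_mul_dist_le_pi (x y : ModelSpace k n) (hk : 0 < k) : √k * dist x y ≤ Real.pi := by
  rw [sqrt_mul_dist_pos_curv hk]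
  exact Real.arccos_le_pi _

/-- A curve parametrized by arc length whose subarcs of length at most `D_k` are geodesics, and
along which the versine of the distance to any point satisfies `f'' = 1 - k f`. -/
structure IsUnitSpeedLine (c : ℝ → ModelSpace k n) : Prop where
  dist_eq : ∀ s t, (0 < k → √k * |s - t| ≤ Real.pi) → dist (c s) (c t) = |s - t|
  genVer_dist_eq : ∀ q, ∃ β, ∀ t, genVer k (dist q (c t)) =
    genVer k t + genCos k t * genVer k (dist q (c 0)) + genSin k t * β

/-- Supplies a tangent direction at a point of the sphere when the second point determines none,
that is, when it is equal or antipodal to the first. -/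
theorem exists_orthonormal_pair (hn : 1 ≤ n) (v : EuclideanSpace ℝ (Fin n)) (h : ℝ)
    (hv : ‖v‖ ^ 2 + h ^ 2 = 1) :
    ∃ (w : EuclideanSpace ℝ (Fin n)) (η : ℝ), inner ℝ v w + h * η = 0 ∧ ‖w‖ ^ 2 + η ^ 2 = 1 := by
  rcases eq_or_ne v 0 with rfl | h0
  · refine ⟨EuclideanSpace.single ⟨0, hn⟩ 1, 0, ?_, ?_⟩ <;> simp
  · have hv0 : ‖v‖ ≠ 0 := norm_ne_zero_iff.2 h0
    refine ⟨(-h / ‖v‖) • v, ‖v‖, ?_, ?_⟩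
    · rw [real_inner_smul_right, real_inner_self_eq_norm_sq]
      field_simp
      ring
    · rw [norm_smul, mul_pow, Real.norm_eq_abs, sq_abs, div_pow, div_mul_cancel₀ _ (by positivity)]
      linarith

/-- The great circle through `x` in the direction of the unit tangent vector `(w, η)`. -/
noncomputable def greatCircle (hk : 0 < k) (x : ModelSpace k n) (w : EuclideanSpace ℝ (Fin n))
    (η : ℝ) (ho : inner ℝ x.vec w + x.height * η = 0) (hw : ‖w‖ ^ 2 + η ^ 2 = 1) (t : ℝ) :
    ModelSpace k n where
  vec := Real.cos (√k * t) • x.vec + Real.sin (√k * t) • w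
  height := Real.cos (√k * t) * x.height + Real.sin (√k * t) * η
  sphere_mem _ := by
    have hx := x.sphere_mem hk
    rw [← real_inner_self_eq_norm_sq] at hx hw ⊢
    simp only [inner_add_left, inner_add_right, real_inner_smul_left, real_inner_smul_right]
    rw [real_inner_comm x.vec w]
    have := Real.sin_sq_add_cos_sq (√k * t)
    linear_combination Real.cos (√k * t) ^ 2 * hx + Real.sin (√k * t) ^ 2 * hw +
      2 * Real.cos (√k * t) * Real.sin (√k * t) * ho + this
  flat_mem h := absurd h hk.ne'
  hyperboloid_mem h := absurd h hk.le.not_gt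

theorem isUnitSpeedLine_greatCircle (hk : 0 < k) (x : ModelSpace k n)
    (w : EuclideanSpace ℝ (Fin n)) (η : ℝ) (ho : inner ℝ x.vec w + x.height * η = 0)
    (hw : ‖w‖ ^ 2 + η ^ 2 = 1) : IsUnitSpeedLine (greatCircle hk x w η ho hw) where
  dist_eq s t hst := by
    have h0 : 0 < √k := Real.sqrt_pos.2 hk
    have hs : scalar (greatCircle hk x w η ho hw s) (greatCircle hk x w η ho hw t) =
        Real.cos (√k * |s - t|) := by
      have hx := x.sphere_mem hk
      have hc : Real.cos (√k * |s - t|) = Real.cos (√k * s - √k * t) := by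
        rw [← Real.cos_abs (√k * s - √k * t), ← mul_sub, abs_mul, abs_of_pos h0]
      rw [hc, Real.cos_sub]
      rw [← real_inner_self_eq_norm_sq] at hx hw
      simp only [scalar, greatCircle, inner_add_left, inner_add_right, real_inner_smul_left,
        real_inner_smul_right]
      rw [real_inner_comm x.vec w]
      linear_combination Real.cos (√k * s) * Real.cos (√k * t) * hx +
        Real.sin (√k * s) * Real.sin (√k * t) * hw +
        (Real.cos (√k * s) * Real.sin (√k * t) + Real.cos (√k * t) * Real.sin (√k * s)) * ho
    rw [dist_pos_curv hk, hs, Real.arccos_cos (by positivity) (hst hk)]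
    field_simp
  genVer_dist_eq q := by
    have h0 : 0 < √k := Real.sqrt_pos.2 hk
    refine ⟨-(√k * (inner ℝ q.vec w + q.height * η) / k), fun t => ?_⟩
    simp only [genVer_dist_pos_curv hk, genVer_pos_curv hk, genCos_pos_curv hk,
      genSin_pos_curv hk]
    simp only [scalar, greatCircle, inner_add_right, real_inner_smul_right, mul_zero, Real.cos_zero,
      Real.sin_zero]
    field_simp
    ring

/-- Gram–Schmidt: the initial direction is y - ⟨x, y⟩ x, normalized. It vanishes exactly when y = ±
x, and then any unit tangent vector serves. -/
theorem exists_line_pos_curv (hk : 0 < k) (hn : 1 ≤ n) (x y : ModelSpace k n) :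
    ∃ c, IsUnitSpeedLine c ∧ c 0 = x ∧ c (dist x y) = y := by
  have hC := abs_le.1 (abs_scalar_le_one hk x y)
  set C := scalar x y with hCdef
  have hx := x.sphere_mem hk
  have hy := y.sphere_mem hk
  have hexp : ‖y.vec - C • x.vec‖ ^ 2 + (y.height - C * x.height) ^ 2 = 1 - C ^ 2 := by
    rw [norm_sub_sq_real, norm_smul, real_inner_smul_right, mul_pow, Real.norm_eq_abs, sq_abs,
      real_inner_comm]
    simp only [scalar] at hCdef
    linear_combination hy + C ^ 2 * hx + 2 * C * hCdef
  have key : ∃ (w : EuclideanSpace ℝ (Fin n)) (η : ℝ), inner ℝ x.vec w + x.height * η = 0 ∧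
      ‖w‖ ^ 2 + η ^ 2 = 1 ∧ C • x.vec + √(1 - C ^ 2) • w = y.vec ∧
      C * x.height + √(1 - C ^ 2) * η = y.height := by
    rcases eq_or_ne (1 - C ^ 2) 0 with h1 | h1
    · obtain ⟨w, η, h2, h3⟩ := exists_orthonormal_pair hn x.vec x.height hx
      rw [h1] at hexp
      have h4 : ‖y.vec - C • x.vec‖ ^ 2 = 0 := by
        nlinarith [sq_nonneg ‖y.vec - C • x.vec‖, sq_nonneg (y.height - C * x.height)]
      have h5 : (y.height - C * x.height) ^ 2 = 0 := by linarith
      have h6 := sub_eq_zero.1 (norm_eq_zero.1 (pow_eq_zero_iff two_ne_zero |>.1 h4))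
      have h7 := sub_eq_zero.1 (pow_eq_zero_iff two_ne_zero |>.1 h5)
      exact ⟨w, η, h2, h3, by simp [h1, h6], by simp [h1, h7]⟩
    · have hpos : 0 < 1 - C ^ 2 := lt_of_le_of_ne (by nlinarith) (Ne.symm h1)
      have hs : 0 < √(1 - C ^ 2) := Real.sqrt_pos.2 hpos
      have hs2 : √(1 - C ^ 2) ^ 2 = 1 - C ^ 2 := Real.sq_sqrt hpos.le
      refine ⟨(√(1 - C ^ 2))⁻¹ • (y.vec - C • x.vec), (√(1 - C ^ 2))⁻¹ * (y.height - C * x.height),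
        ?_, ?_, ?_, ?_⟩
      · rw [real_inner_smul_right, inner_sub_right, real_inner_smul_right,
          real_inner_self_eq_norm_sq]
        simp only [scalar] at hCdef
        linear_combination (√(1 - C ^ 2))⁻¹ * (-hCdef - C * hx)
      · rw [norm_smul, mul_pow, mul_pow, norm_inv, Real.norm_eq_abs, abs_of_pos hs,
          ← mul_add, hexp, inv_pow, hs2, inv_mul_cancel₀ h1]
      · rw [smul_inv_smul₀ hs.ne']
        abel
      · rw [mul_inv_cancel_left₀ hs.ne']
        ring
  obtain ⟨w, η, ho, hw, h1, h2⟩ := key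
  refine ⟨greatCircle hk x w η ho hw, isUnitSpeedLine_greatCircle hk x w η ho hw, ?_, ?_⟩
  · ext1 <;> simp [greatCircle]
  · ext1 <;> simp only [greatCircle, sqrt_mul_dist_pos_curv hk, ← hCdef,
      Real.cos_arccos hC.1 hC.2, Real.sin_arccos]
    exacts [h1, h2]

/-- The straight line through `x` in the direction `w`. -/
noncomputable def straightLine (x : ModelSpace 0 n) (w : EuclideanSpace ℝ (Fin n)) (t : ℝ) :
    ModelSpace 0 n where
  vec := x.vec + t • w
  height := 0
  sphere_mem h := absurd h (lt_irrefl _)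
  flat_mem _ := rfl
  hyperboloid_mem h := absurd h (lt_irrefl _)

theorem exists_line_flat (hn : 1 ≤ n) (x y : ModelSpace 0 n) :
    ∃ c, IsUnitSpeedLine c ∧ c 0 = x ∧ c (dist x y) = y := by
  have key : ∃ w : EuclideanSpace ℝ (Fin n), ‖w‖ = 1 ∧ x.vec + dist x y • w = y.vec := by
    rw [dist_flat]
    rcases eq_or_ne x.vec y.vec with h | h
    · exact ⟨EuclideanSpace.single ⟨0, hn⟩ 1, by simp, by simp [h]⟩
    · have h0 : ‖y.vec - x.vec‖ ≠ 0 := norm_ne_zero_iff.2 (sub_ne_zero.2 h.symm)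
      refine ⟨‖y.vec - x.vec‖⁻¹ • (y.vec - x.vec), ?_, ?_⟩
      · rw [norm_smul, norm_inv, norm_norm, inv_mul_cancel₀ h0]
      · rw [dist_eq_norm', smul_inv_smul₀ h0]
        abel
  obtain ⟨w, hw, h1⟩ := key
  refine ⟨straightLine x w, ⟨fun s t _ => ?_, fun q => ⟨-inner ℝ (q.vec - x.vec) w, fun t => ?_⟩⟩,
    ?_, ?_⟩
  · rw [dist_flat, dist_eq_norm]
    simp only [straightLine]
    rw [add_sub_add_left_eq_sub, ← sub_smul, norm_smul, hw, mul_one, Real.norm_eq_abs]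
  · rw [genVer_dist_flat, genVer_dist_flat, genVer_flat, genCos_flat, genSin_flat]
    simp only [straightLine]
    rw [← sub_sub, norm_sub_sq_real, norm_smul, hw, real_inner_smul_right, zero_smul, add_zero,
      mul_one, Real.norm_eq_abs, sq_abs]
    ring
  · ext1
    · simp [straightLine]
    · simp [straightLine, x.flat_mem rfl]
  · ext1
    · simpa [straightLine] using h1
    · simp [straightLine, y.flat_mem rfl]

/-- Cauchy–Schwarz applied to the orthogonality relation. The bound keeps hyperbolic lines on the
upper sheet. -/
theorem tangent_height_sq_lt (hk : k < 0) (x : ModelSpace k n) (w : EuclideanSpace ℝ (Fin n))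
    (η : ℝ) (ho : inner ℝ x.vec w - x.height * η = 0) (hw : ‖w‖ ^ 2 - η ^ 2 = 1) :
    |η| < x.height := by
  obtain ⟨hx, hx0⟩ := x.hyperboloid_mem hk
  have h1 : (x.height * η) ^ 2 ≤ (‖x.vec‖ * ‖w‖) ^ 2 := by
    have : x.height * η = inner ℝ x.vec w := by linarith
    rw [this, ← sq_abs]
    exact pow_le_pow_left₀ (abs_nonneg _) (abs_real_inner_le_norm _ _) 2
  rw [mul_pow, mul_pow, show ‖x.vec‖ ^ 2 = x.height ^ 2 - 1 by linarith,
    show ‖w‖ ^ 2 = 1 + η ^ 2 by linarith] at h1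
  refine abs_lt_of_sq_lt_sq ?_ hx0.le
  nlinarith

/-- The hyperbolic line through `x` in the direction of the unit tangent vector `(w, η)`. -/
noncomputable def hyperbolicLine (hk : k < 0) (x : ModelSpace k n) (w : EuclideanSpace ℝ (Fin n))
    (η : ℝ) (ho : inner ℝ x.vec w - x.height * η = 0) (hw : ‖w‖ ^ 2 - η ^ 2 = 1) (t : ℝ) :
    ModelSpace k n where
  vec := Real.cosh (√(-k) * t) • x.vec + Real.sinh (√(-k) * t) • w
  height := Real.cosh (√(-k) * t) * x.height + Real.sinh (√(-k) * t) * η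
  sphere_mem h := absurd h hk.le.not_gt
  flat_mem h := absurd h hk.ne
  hyperboloid_mem _ := by
    obtain ⟨hx, hx0⟩ := x.hyperboloid_mem hk
    have hη := abs_lt.1 (tangent_height_sq_lt hk x w η ho hw)
    constructor
    · rw [← real_inner_self_eq_norm_sq] at hx hw ⊢
      simp only [inner_add_left, inner_add_right, real_inner_smul_left, real_inner_smul_right]
      rw [real_inner_comm x.vec w]
      have := Real.cosh_sq_sub_sinh_sq (√(-k) * t)
      linear_combination Real.cosh (√(-k) * t) ^ 2 * hx + Real.sinh (√(-k) * t) ^ 2 * hw +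
        2 * Real.cosh (√(-k) * t) * Real.sinh (√(-k) * t) * ho - this
    -- In exponentials, twice the height is e^s (x₀ + η) + e^(-s) (x₀ - η), and both brackets are
    -- positive.
    · rw [Real.cosh_eq, Real.sinh_eq]
      have e1 := Real.exp_pos (√(-k) * t)
      have e2 := Real.exp_pos (-(√(-k) * t))
      nlinarith [mul_pos e1 (show 0 < x.height + η by linarith),
        mul_pos e2 (show 0 < x.height - η by linarith)]

theorem isUnitSpeedLine_hyperbolicLine (hk : k < 0) (x : ModelSpace k n)
    (w : EuclideanSpace ℝ (Fin n)) (η : ℝ) (ho : inner ℝ x.vec w - x.height * η = 0)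
    (hw : ‖w‖ ^ 2 - η ^ 2 = 1) : IsUnitSpeedLine (hyperbolicLine hk x w η ho hw) where
  dist_eq s t _ := by
    have h0 : 0 < √(-k) := Real.sqrt_pos.2 (by linarith)
    have hs : -lorentz (hyperbolicLine hk x w η ho hw s) (hyperbolicLine hk x w η ho hw t) =
        Real.cosh (√(-k) * |s - t|) := by
      have hx := (x.hyperboloid_mem hk).1
      have hc : Real.cosh (√(-k) * |s - t|) = Real.cosh (√(-k) * s - √(-k) * t) := by
        rw [← Real.cosh_abs (√(-k) * s - √(-k) * t), ← mul_sub, abs_mul, abs_of_pos h0]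
      rw [hc, Real.cosh_sub]
      rw [← real_inner_self_eq_norm_sq] at hx hw
      simp only [lorentz, hyperbolicLine, inner_add_left, inner_add_right, real_inner_smul_left,
        real_inner_smul_right]
      rw [real_inner_comm x.vec w]
      linear_combination -Real.cosh (√(-k) * s) * Real.cosh (√(-k) * t) * hx -
        Real.sinh (√(-k) * s) * Real.sinh (√(-k) * t) * hw -
        (Real.cosh (√(-k) * s) * Real.sinh (√(-k) * t) +
          Real.cosh (√(-k) * t) * Real.sinh (√(-k) * s)) * ho
    rw [dist_neg_curv hk, hs, Real.arcosh_cosh (by positivity)]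
    field_simp
  genVer_dist_eq q := by
    have h0 : 0 < √(-k) := Real.sqrt_pos.2 (by linarith)
    have hk0 := hk.ne
    refine ⟨√(-k) * (inner ℝ q.vec w - q.height * η) / k, fun t => ?_⟩
    simp only [genVer_dist_neg_curv hk, genVer_neg_curv hk, genCos_neg_curv hk,
      genSin_neg_curv hk]
    simp only [lorentz, hyperbolicLine, inner_add_right, real_inner_smul_right, mul_zero,
      Real.cosh_zero, Real.sinh_zero]
    field_simp
    ring

/-- The Lorentzian Gram–Schmidt construction: y - C x is orthogonal to x and has squared length C² -
1, which is positive because x and y differ. -/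
theorem exists_line_neg_curv_of_ne (hk : k < 0) {x y : ModelSpace k n} (hxy : x ≠ y) :
    ∃ c, IsUnitSpeedLine c ∧ c 0 = x ∧ c (dist x y) = y := by
  have hC := one_le_neg_lorentz hk x y
  set C := -lorentz x y with hCdef
  have hx := (x.hyperboloid_mem hk).1
  have hy := (y.hyperboloid_mem hk).1
  have hexp : ‖y.vec - C • x.vec‖ ^ 2 - (y.height - C * x.height) ^ 2 = C ^ 2 - 1 := by
    rw [norm_sub_sq_real, norm_smul, real_inner_smul_right, mul_pow, Real.norm_eq_abs, sq_abs,
      real_inner_comm]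
    simp only [lorentz] at hCdef
    linear_combination hy + C ^ 2 * hx - 2 * C * hCdef
  have h1 : C ≠ 1 := by
    intro h
    apply hxy
    rw [← dist_eq_zero, dist_neg_curv hk, ← hCdef, h, Real.arcosh_zero, zero_div]
  have hlt : 1 < C := lt_of_le_of_ne hC h1.symm
  have hpos : 0 < C ^ 2 - 1 := by nlinarith
  have hs : 0 < √(C ^ 2 - 1) := Real.sqrt_pos.2 hpos
  have hs2 : √(C ^ 2 - 1) ^ 2 = C ^ 2 - 1 := Real.sq_sqrt hpos.le
  have ho : inner ℝ x.vec ((√(C ^ 2 - 1))⁻¹ • (y.vec - C • x.vec)) -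
      x.height * ((√(C ^ 2 - 1))⁻¹ * (y.height - C * x.height)) = 0 := by
    rw [real_inner_smul_right, inner_sub_right, real_inner_smul_right, real_inner_self_eq_norm_sq]
    simp only [lorentz] at hCdef
    linear_combination (√(C ^ 2 - 1))⁻¹ * (hCdef - C * hx)
  have hw : ‖(√(C ^ 2 - 1))⁻¹ • (y.vec - C • x.vec)‖ ^ 2 -
      ((√(C ^ 2 - 1))⁻¹ * (y.height - C * x.height)) ^ 2 = 1 := by
    rw [norm_smul, mul_pow, mul_pow, norm_inv, Real.norm_eq_abs, abs_of_pos hs, ← mul_sub, hexp,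
      inv_pow, hs2, inv_mul_cancel₀ hpos.ne']
  refine ⟨hyperbolicLine hk x _ _ ho hw, isUnitSpeedLine_hyperbolicLine hk x _ _ ho hw, ?_, ?_⟩
  · ext1 <;> simp [hyperbolicLine]
  · ext1 <;> simp only [hyperbolicLine, sqrt_mul_dist_neg_curv hk, ← hCdef,
      Real.cosh_arcosh hC, Real.sinh_arcosh hC]
    · rw [smul_inv_smul₀ hs.ne']
      abel
    · rw [mul_inv_cancel_left₀ hs.ne']
      ring

theorem exists_ne_of_neg_curv (hk : k < 0) (hn : 1 ≤ n) (x : ModelSpace k n) :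
    ∃ y : ModelSpace k n, x ≠ y := by
  let p : ModelSpace k n := ⟨0, 1, fun h => absurd h hk.le.not_gt, fun h => absurd h hk.ne,
    fun _ => by simp⟩
  let q : ModelSpace k n := ⟨EuclideanSpace.single ⟨0, hn⟩ 1, √2,
    fun h => absurd h hk.le.not_gt, fun h => absurd h hk.ne, fun _ => by norm_num⟩
  by_cases h : x = p
  · refine ⟨q, fun hq => ?_⟩
    have h2 := congrArg (fun z => ‖z.vec‖) (h.symm.trans hq)
    simp [p, q] at h2
  · exact ⟨p, h⟩

theorem exists_line (hn : 1 ≤ n) (x y : ModelSpace k n) :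
    ∃ c, IsUnitSpeedLine c ∧ c 0 = x ∧ c (dist x y) = y := by
  rcases lt_trichotomy k 0 with hk | rfl | hk
  · rcases eq_or_ne x y with rfl | h
    · obtain ⟨y, hy⟩ := exists_ne_of_neg_curv hk hn x
      obtain ⟨c, hc, h0, -⟩ := exists_line_neg_curv_of_ne hk hy
      exact ⟨c, hc, h0, by rw [dist_self, h0]⟩
    · exact exists_line_neg_curv_of_ne hk h
  · exact exists_line_flat hn x y
  · exact exists_line_pos_curv hk hn x y

/-! ### Properness -/

/-- The points of `ℝ^n × ℝ` which are the coordinates of a point of the model space. -/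
def coordinates (k : ℝ) (n : ℕ) : Set (EuclideanSpace ℝ (Fin n) × ℝ) :=
  {p | (0 < k → ‖p.1‖ ^ 2 + p.2 ^ 2 = 1) ∧ (k = 0 → p.2 = 0) ∧
    (k < 0 → ‖p.1‖ ^ 2 - p.2 ^ 2 = -1 ∧ 0 ≤ p.2)}

theorem isClosed_coordinates (k : ℝ) (n : ℕ) : IsClosed (coordinates k n) := by
  have h1 : IsClosed {p : EuclideanSpace ℝ (Fin n) × ℝ | ‖p.1‖ ^ 2 + p.2 ^ 2 = 1} :=
    isClosed_eq (by fun_prop) (by fun_prop)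
  have h2 : IsClosed {p : EuclideanSpace ℝ (Fin n) × ℝ | p.2 = 0} :=
    isClosed_eq (by fun_prop) (by fun_prop)
  have h3 : IsClosed {p : EuclideanSpace ℝ (Fin n) × ℝ | ‖p.1‖ ^ 2 - p.2 ^ 2 = -1 ∧ 0 ≤ p.2} :=
    IsClosed.inter (isClosed_eq (by fun_prop) (by fun_prop))
      (isClosed_le continuous_const continuous_snd)
  have e : coordinates k n =
      {p | 0 < k → p ∈ {p : EuclideanSpace ℝ (Fin n) × ℝ | ‖p.1‖ ^ 2 + p.2 ^ 2 = 1}} ∩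
      ({p | k = 0 → p ∈ {p : EuclideanSpace ℝ (Fin n) × ℝ | p.2 = 0}} ∩
      {p | k < 0 → p ∈ {p : EuclideanSpace ℝ (Fin n) × ℝ |
        ‖p.1‖ ^ 2 - p.2 ^ 2 = -1 ∧ 0 ≤ p.2}}) := rfl
  rw [e]
  refine IsClosed.inter ?_ (IsClosed.inter ?_ ?_)
  · by_cases h : 0 < k
    · simpa [h] using h1
    · simp [h]
  · by_cases h : k = 0
    · simpa [h] using h2
    · simp [h]
  · by_cases h : k < 0
    · simpa [h] using h3
    · simp [h]

/-- The point with given coordinates. -/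
def ofCoordinates (p : coordinates k n) : ModelSpace k n where
  vec := p.1.1
  height := p.1.2
  sphere_mem := p.2.1
  flat_mem := p.2.2.1
  hyperboloid_mem hk := by
    obtain ⟨h1, h2⟩ := p.2.2.2 hk
    -- `coordinates` uses a weak inequality in order to be closed; height 0 is impossible, since it
    -- would give ‖vec‖² = -1.
    exact ⟨h1, lt_of_le_of_ne h2 fun h => by
      rw [← h] at h1
      nlinarith [sq_nonneg ‖p.1.1‖]⟩

theorem continuous_ofCoordinates : Continuous (ofCoordinates : coordinates k n → ModelSpace k n) := by
  rw [continuous_iff_continuousAt]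
  intro p
  rw [ContinuousAt, tendsto_iff_dist_tendsto_zero, ← dist_self (ofCoordinates p)]
  have hs : Continuous fun q : coordinates k n => scalar (ofCoordinates q) (ofCoordinates p) := by
    simp only [scalar, ofCoordinates]
    fun_prop
  have hl : Continuous fun q : coordinates k n => -lorentz (ofCoordinates q) (ofCoordinates p) := by
    simp only [lorentz, ofCoordinates]
    fun_prop
  refine Continuous.tendsto (f := fun q : coordinates k n =>
    dist (ofCoordinates q) (ofCoordinates p)) ?_ p
  rcases lt_trichotomy k 0 with hk | rfl | hk
  · simp only [dist_neg_curv hk]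
    exact (Real.continuousOn_arcosh.comp_continuous hl
      fun q => one_le_neg_lorentz hk _ _).div_const _
  · simp only [dist_flat, ofCoordinates]
    fun_prop
  · simp only [dist_pos_curv hk]
    exact (Real.continuous_arccos.comp hs).div_const _

/-- In the hyperbolic case the height is the hyperbolic cosine of the scaled distance to the vertex
o of the hyperboloid, and it dominates ‖vec‖. -/
theorem exists_norm_le_of_dist_le (p : ModelSpace k n) (r : ℝ) :
    ∃ ρ, ∀ x : ModelSpace k n, dist x p ≤ r → ‖(x.vec, x.height)‖ ≤ ρ := by
  rcases lt_trichotomy k 0 with hk | rfl | hk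
  · let o : ModelSpace k n := ⟨0, 1, fun h => absurd h hk.le.not_gt, fun h => absurd h hk.ne,
      fun _ => by simp⟩
    refine ⟨Real.cosh (√(-k) * (r + dist p o)), fun x hx => ?_⟩
    obtain ⟨hx1, hx0⟩ := x.hyperboloid_mem hk
    have h1 : dist x o ≤ r + dist p o := (dist_triangle x p o).trans (by linarith)
    have h2 : x.height = Real.cosh (√(-k) * dist x o) := by
      rw [sqrt_mul_dist_neg_curv hk, Real.cosh_arcosh (one_le_neg_lorentz hk x o)]
      simp [lorentz, o]
    have h3 : x.height ≤ Real.cosh (√(-k) * (r + dist p o)) := by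
      rw [h2, Real.cosh_le_cosh, abs_of_nonneg (by positivity)]
      exact (mul_le_mul_of_nonneg_left h1 (by positivity)).trans (le_abs_self _)
    refine max_le ?_ ?_
    · refine le_trans ?_ h3
      exact le_of_sq_le_sq (by linarith) hx0.le
    · rwa [Real.norm_eq_abs, abs_of_pos hx0]
  · refine ⟨r + ‖p.vec‖, fun x hx => ?_⟩
    rw [dist_flat, dist_eq_norm] at hx
    have h1 : ‖x.vec‖ ≤ r + ‖p.vec‖ := by linarith [norm_le_insert' x.vec p.vec]
    refine max_le h1 ?_
    rw [x.flat_mem rfl]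
    simpa using (norm_nonneg _).trans h1
  · refine ⟨1, fun x _ => ?_⟩
    have hx := x.sphere_mem hk
    refine max_le ?_ ?_
    · exact le_of_sq_le_sq (by nlinarith [sq_nonneg x.height]) one_pos.le
    · rw [Real.norm_eq_abs]
      exact abs_le_of_sq_le_sq (by nlinarith [sq_nonneg ‖x.vec‖]) one_pos.le

/-- Properness gives the existence of nearest points in closed sets. -/
instance : ProperSpace (ModelSpace k n) where
  isCompact_closedBall p r := by
    obtain ⟨ρ, hρ⟩ := exists_norm_le_of_dist_le p r
    have hK : IsCompact ((Subtype.val : coordinates k n → _) ⁻¹' Metric.closedBall 0 ρ) :=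
      (isClosed_coordinates k n).isClosedEmbedding_subtypeVal.isCompact_preimage
        (isCompact_closedBall 0 ρ)
    refine (hK.image continuous_ofCoordinates).of_isClosed_subset Metric.isClosed_closedBall ?_
    intro x hx
    refine ⟨⟨(x.vec, x.height), x.sphere_mem, x.flat_mem, fun hk =>
      ⟨(x.hyperboloid_mem hk).1, (x.hyperboloid_mem hk).2.le⟩⟩, ?_, rfl⟩
    simpa using hρ x hx

end ModelSpace

/-! ### Projections and reflections in the model spaces -/

open Filter Topology

namespace ModelSpace

variable {k : ℝ} {n : ℕ}

/-! ### Determination of points by distances along a line -/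

theorem dist_le_of_genVer_le {x y u v : ModelSpace k n}
    (h : genVer k (dist x y) ≤ genVer k (dist u v)) : dist x y ≤ dist u v := by
  by_contra! hlt
  exact absurd (genVer_lt_genVer dist_nonneg hlt (sqrt_mul_dist_le_pi x y)) h.not_gt

theorem eq_of_genVer_dist_le_zero {x y : ModelSpace k n} (h : genVer k (dist x y) ≤ 0) :
    x = y := by
  have : dist x y ≤ dist x x := dist_le_of_genVer_le (by rwa [dist_self, genVer_zero])
  rw [dist_self] at this
  exact dist_le_zero.1 this

/-- A solution of f'' = 1 - k f is determined by its values at 0 and r when S(r) ≠ 0, which holds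
for 0 < r < D_k. -/
theorem IsUnitSpeedLine.dist_eq_of_dist_eq {c : ℝ → ModelSpace k n} (hc : IsUnitSpeedLine c)
    {r : ℝ} (hr : 0 < r) (hrk : 0 < k → √k * r < Real.pi) {q q' : ModelSpace k n}
    (h0 : dist q (c 0) = dist q' (c 0)) (h1 : dist q (c r) = dist q' (c r)) (t : ℝ) :
    dist q (c t) = dist q' (c t) := by
  obtain ⟨β, hβ⟩ := hc.genVer_dist_eq q
  obtain ⟨β', hβ'⟩ := hc.genVer_dist_eq q'
  have e : genSin k r * β = genSin k r * β' := by
    have e1 := hβ r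
    have e2 := hβ' r
    rw [h0, h1] at e1
    linarith
  have hβ0 : β = β' := mul_left_cancel₀ (genSin_pos hr hrk).ne' e
  have e3 : genVer k (dist q (c t)) = genVer k (dist q' (c t)) := by
    rw [hβ t, hβ' t, h0, hβ0]
  exact le_antisymm (dist_le_of_genVer_le e3.le) (dist_le_of_genVer_le e3.ge)

theorem IsUnitSpeedLine.dist_zero {c : ℝ → ModelSpace k n} (hc : IsUnitSpeedLine c) {r : ℝ}
    (hr : 0 ≤ r) (hrk : 0 < k → √k * r ≤ Real.pi) : dist (c 0) (c r) = r := by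
  rw [hc.dist_eq 0 r (by simpa [abs_of_nonneg hr] using hrk), zero_sub, abs_neg, abs_of_nonneg hr]

theorem IsUnitSpeedLine.dist_of_le {c : ℝ → ModelSpace k n} (hc : IsUnitSpeedLine c) {l s t : ℝ}
    (hl : 0 < k → √k * l ≤ Real.pi) (hs : 0 ≤ s) (hst : s ≤ t) (ht : t ≤ l) :
    dist (c s) (c t) = t - s := by
  rw [hc.dist_eq s t, abs_sub_comm, abs_of_nonneg (sub_nonneg.2 hst)]
  intro hk
  rw [abs_sub_comm, abs_of_nonneg (sub_nonneg.2 hst)]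
  exact (mul_le_mul_of_nonneg_left (by linarith) (Real.sqrt_nonneg _)).trans (hl hk)

theorem IsUnitSpeedLine.eq_of_dist_add {c : ℝ → ModelSpace k n} (hc : IsUnitSpeedLine c)
    {s t : ℝ} (hs : 0 ≤ s) (ht : 0 ≤ t) (hk : 0 < k → √k * (s + t) < Real.pi)
    {p : ModelSpace k n} (h0 : dist p (c 0) = s) (h1 : dist p (c (s + t)) = t) : p = c s := by
  rcases (add_nonneg hs ht).eq_or_lt with h | h
  · have : s = 0 := by linarith
    rw [this, dist_eq_zero] at h0
    rw [this, h0]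
  · have hle : 0 < k → √k * (s + t) ≤ Real.pi := fun h => (hk h).le
    rw [← dist_eq_zero, hc.dist_eq_of_dist_eq h hk (q' := c s), dist_self]
    · rw [h0, dist_comm, hc.dist_of_le hle le_rfl hs (by linarith), sub_zero]
    · rw [h1, hc.dist_of_le hle hs (by linarith) le_rfl]
      ring

/-- Geodesics of length less than `D_k` have at most one extension of given length. -/
theorem eq_of_extends (hn : 1 ≤ n) {x p z z' : ModelSpace k n} {s t : ℝ} (hs : 0 < s)
    (ht : 0 ≤ t) (hk : 0 < k → √k * (s + t) < Real.pi) (hxp : dist x p = s)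
    (hpz : dist p z = t) (hxz : dist x z = s + t) (hpz' : dist p z' = t)
    (hxz' : dist x z' = s + t) : z = z' := by
  obtain ⟨c, hc, h0, h1⟩ := exists_line hn x z
  rw [hxz] at h1
  have hp : p = c s := hc.eq_of_dist_add hs.le ht hk (by rw [h0, dist_comm, hxp])
    (by rw [h1, hpz])
  have hsk : 0 < k → √k * s < Real.pi := fun h =>
    (mul_le_mul_of_nonneg_left (by linarith) (Real.sqrt_nonneg k)).trans_lt (hk h)
  -- z and z' are equidistant from `c 0` = x and `c s` = p, hence from every point of the line, in
  -- particular from z itself.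
  have := hc.dist_eq_of_dist_eq hs hsk (q := z) (q' := z')
    (by rw [h0, dist_comm, hxz, dist_comm, hxz'])
    (by rw [← hp, dist_comm, hpz, dist_comm, hpz']) (s + t)
  rw [h1, dist_self] at this
  exact (dist_eq_zero.1 this.symm).symm

/-- The median formula. Expanding from x at times h and 2h, the unknown β is eliminated by S(2h) = 2
S(h) C(h). -/
theorem genVer_dist_add_of_midpoint (hn : 1 ≤ n) {x p z : ModelSpace k n} {h : ℝ}
    (hk : 0 < k → √k * h < Real.pi / 2) (hxp : dist x p = h) (hzp : dist z p = h)
    (hxz : dist x z = 2 * h) (q : ModelSpace k n) :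
    genVer k (dist q x) + genVer k (dist q z) =
      2 * genVer k h + 2 * genCos k h * genVer k (dist q p) := by
  obtain ⟨c, hc, h0, h1⟩ := exists_line hn x z
  have hh : 0 ≤ h := hxp ▸ dist_nonneg
  rw [hxz] at h1
  have hp : p = c h := hc.eq_of_dist_add hh hh (fun hk0 => by linarith [hk hk0])
    (by rw [h0, dist_comm, hxp]) (by rw [← two_mul, h1, dist_comm, hzp])
  obtain ⟨β, hβ⟩ := hc.genVer_dist_eq q
  have e1 := hβ h
  have e2 := hβ (2 * h)
  rw [← hp, h0] at e1
  rw [h1, h0, genVer_two_mul, genCos_two_mul, genSin_two_mul] at e2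
  rw [e1, e2]
  ring

theorem IsUnitSpeedLine.isGeodesic {c : ℝ → ModelSpace k n} (hc : IsUnitSpeedLine c)
    {x y : ModelSpace k n} (h0 : c 0 = x) (h1 : c (dist x y) = y) :
    IsGeodesic c (dist x y) x y := by
  refine ⟨dist_nonneg, h0, h1, fun s hs t ht => hc.dist_eq s t fun hk => ?_⟩
  refine (mul_le_mul_of_nonneg_left ?_ (Real.sqrt_nonneg k)).trans (sqrt_mul_dist_le_pi x y hk)
  rw [abs_le]
  constructor <;> linarith [hs.1, hs.2, ht.1, ht.2]

theorem IsUnitSpeedLine.isGeodesicLine {c : ℝ → ModelSpace k n} (hc : IsUnitSpeedLine c) :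
    IsGeodesicLine (Set.range c) :=
  ⟨c, rfl, fun s t h => hc.dist_eq s t (ofReal_le_modelDiam.1 h)⟩

theorem _root_.dist_le_of_mem_metricProj {X : Type*} [MetricSpace X] {C : Set X} {x p q : X}
    (hp : p ∈ metricProj C x) (hq : q ∈ C) : dist x p ≤ dist x q :=
  hp.2.trans_le (Metric.infDist_le_dist_of_mem hq)

/-- The projection onto a convex set makes an angle of at least `π / 2` with the set. -/
theorem genVer_dist_ge_of_mem_metricProj (hn : 1 ≤ n) {C : Set (ModelSpace k n)}
    (hC : IsGeodesicallyConvex C) {x p q : ModelSpace k n} (hp : p ∈ metricProj C x)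
    (hq : q ∈ C) :
    genVer k (dist x p) + genCos k (dist x p) * genVer k (dist p q) ≤ genVer k (dist x q) := by
  rcases eq_or_ne p q with rfl | hpq
  · simp [genVer_zero]
  obtain ⟨c, hc, h0, h1⟩ := exists_line hn p q
  have hl : 0 < dist p q := dist_pos.2 hpq
  have hseg : c '' Set.Icc 0 (dist p q) ⊆ C :=
    hC p hp.1 q hq _ ⟨c, _, hc.isGeodesic h0 h1, rfl⟩
  obtain ⟨β, hβ⟩ := hc.genVer_dist_eq x
  -- The unknown β is the derivative at 0, because V'(0) = 0 and S'(0) = 1. It is nonnegative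
  -- because the right-hand slopes are: p minimizes the distance to x along the segment.
  have hd : HasDerivAt (fun t => genVer k (dist x (c t))) β 0 := by
    have hV := hasDerivAt_genVer_zero k
    have hS := hasDerivAt_genSin_zero k
    have := (hV.add (((hV.const_mul k).const_sub 1).mul_const (genVer k (dist x (c 0))))).add
      (hS.mul_const β)
    simp only [mul_zero, neg_zero, zero_mul, add_zero, zero_add, one_mul] at this
    exact this.congr_of_eventuallyEq (Eventually.of_forall hβ)
  have hβ0 : 0 ≤ β := by
    have ht := (hasDerivWithinAt_iff_tendsto_slope' (s := Set.Ioi 0) (lt_irrefl _)).1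
      hd.hasDerivWithinAt
    refine ge_of_tendsto ht ?_
    filter_upwards [Ioo_mem_nhdsGT hl] with t ht
    rw [slope_def_field]
    refine div_nonneg (sub_nonneg.2 ?_) (by linarith [ht.1])
    rw [h0]
    rcases (dist_le_of_mem_metricProj hp (hseg ⟨t, ⟨ht.1.le, ht.2.le⟩, rfl⟩)).eq_or_lt with h | h
    · rw [h]
    · exact (genVer_lt_genVer dist_nonneg h (sqrt_mul_dist_le_pi _ _)).le
  have e := hβ (dist p q)
  rw [h1, h0] at e
  have := mul_nonneg (genSin_nonneg hl.le (sqrt_mul_dist_le_pi p q)) hβ0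
  rw [e]
  simp only [genCos]
  linarith

/-- The distance from `x` to some point of `C` is less than `D_k / 2`. -/
def IsNear (C : Set (ModelSpace k n)) (x : ModelSpace k n) : Prop :=
  ∃ q ∈ C, 0 < k → √k * dist x q < Real.pi / 2

theorem IsNear.of_mem_metricProj {C : Set (ModelSpace k n)} {x p : ModelSpace k n}
    (h : IsNear C x) (hp : p ∈ metricProj C x) (hk : 0 < k) : √k * dist x p < Real.pi / 2 := by
  obtain ⟨q, hq, hxq⟩ := h
  exact (mul_le_mul_of_nonneg_left (dist_le_of_mem_metricProj hp hq)
    (Real.sqrt_nonneg k)).trans_lt (hxq hk)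

/-- For a second nearest point q the projection inequality reads C(xp) V(pq) ≤ 0, and C(xp) > 0
below D_k/2. -/
theorem IsNear.exists_metricProj_eq (hn : 1 ≤ n) {C : Set (ModelSpace k n)} (hcl : IsClosed C)
    (hC : IsGeodesicallyConvex C) {x : ModelSpace k n} (h : IsNear C x) :
    ∃ p, metricProj C x = {p} := by
  obtain ⟨p, hpC, hp⟩ := hcl.exists_infDist_eq_dist (h.imp fun _ hq => hq.1) x
  have hpm : p ∈ metricProj C x := ⟨hpC, hp.symm⟩
  refine ⟨p, Set.eq_singleton_iff_unique_mem.2 ⟨hpm, fun q hq => ?_⟩⟩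
  have hV := genVer_dist_ge_of_mem_metricProj hn hC hpm hq.1
  have he : dist x q = dist x p := hq.2.trans hp
  rw [he] at hV
  have hcos := genCos_pos dist_nonneg (h.of_mem_metricProj hpm)
  refine (eq_of_genVer_dist_le_zero ?_).symm
  by_contra! hlt
  linarith [mul_pos hcos hlt]

/-! ### Reflection in a convex subset of a model space -/

theorem exists_line_extending (hn : 1 ≤ n) (a p : ModelSpace k n) {r : ℝ} (hr : 0 ≤ r)
    (hk : 0 < k → √k * (dist a p + r) ≤ Real.pi) :
    ∃ w, (∃ S L, IsGeodesicSegment S a p ∧ IsGeodesicLine L ∧ S ⊆ L ∧ w ∈ L) ∧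
      dist p w = r ∧ dist a w = dist a p + r := by
  obtain ⟨c, hc, h0, h1⟩ := exists_line hn a p
  refine ⟨c (dist a p + r), ⟨_, _, ⟨c, _, hc.isGeodesic h0 h1, rfl⟩, hc.isGeodesicLine,
    Set.image_subset_range _ _, Set.mem_range_self _⟩, ?_, ?_⟩
  · have e := hc.dist_of_le hk (dist_nonneg (x := a) (y := p)) (by linarith) le_rfl
    rwa [h1, add_sub_cancel_left] at e
  · have e := hc.dist_zero (add_nonneg (dist_nonneg (x := a) (y := p)) hr) hk
    rwa [h0] at e

theorem IsReflection.eq (hn : 1 ≤ n) {C : Set (ModelSpace k n)} {x z z' : ModelSpace k n}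
    (h : IsNear C x) (hz : IsReflection C x z) (hz' : IsReflection C x z') : z = z' := by
  obtain ⟨p, hp, -, h1, h2⟩ := hz
  obtain ⟨p', hp', -, h1', h2'⟩ := hz'
  obtain rfl : p = p' := Set.singleton_injective (hp.symm.trans hp')
  rcases (dist_nonneg (x := x) (y := p)).eq_or_lt with h0 | h0
  · have e1 : dist x z = 0 := by linarith
    have e2 : dist x z' = 0 := by linarith
    rw [← dist_eq_zero.1 e1, ← dist_eq_zero.1 e2]
  · refine eq_of_extends hn h0 h0.le (fun hk => ?_) rfl (by rw [dist_comm]; linarith)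
      (by linarith) (by rw [dist_comm]; linarith) (by linarith)
    have := h.of_mem_metricProj (hp ▸ Set.mem_singleton p) hk
    linarith

theorem IsNear.existsUnique_isReflection (hn : 1 ≤ n) {C : Set (ModelSpace k n)}
    (hcl : IsClosed C) (hC : IsGeodesicallyConvex C) {x : ModelSpace k n} (h : IsNear C x) :
    ∃! z, IsReflection C x z := by
  obtain ⟨p, hp⟩ := h.exists_metricProj_eq hn hcl hC
  have hpm : p ∈ metricProj C x := hp ▸ Set.mem_singleton p
  obtain ⟨z, hz, h1, h2⟩ := exists_line_extending hn x p (r := dist x p) dist_nonneg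
    fun hk => by linarith [h.of_mem_metricProj hpm hk]
  have hr : IsReflection C x z :=
    ⟨p, hp, hz, by linarith, by rw [dist_comm]; linarith⟩
  exact ⟨z, hr, fun z' hz' => hz'.eq hn h hr⟩

theorem IsReflection.eq_self {C : Set (ModelSpace k n)} {x z : ModelSpace k n} (hx : x ∈ C)
    (hz : IsReflection C x z) : z = x := by
  obtain ⟨p, hp, -, h1, -⟩ := hz
  have hpm : p ∈ metricProj C x := hp ▸ Set.mem_singleton p
  have h0 : dist x p ≤ dist x x := dist_le_of_mem_metricProj hpm hx
  rw [dist_self] at h0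
  have : dist x z ≤ 0 := by linarith
  exact (dist_le_zero.1 this).symm

/-- The median formula expresses V(zw) - V(xy) through distances among x, y, p, q: apply it to (x,
z) seen from w, and to (y, w) seen from p and from x. The two projection inequalities, weighted by
C(yq) and C(xp), then bound the difference by 0. -/
theorem IsReflection.dist_le (hn : 1 ≤ n) {C : Set (ModelSpace k n)}
    (hC : IsGeodesicallyConvex C) {x y z w : ModelSpace k n} (hx : IsNear C x) (hy : IsNear C y)
    (hz : IsReflection C x z) (hw : IsReflection C y w) : dist z w ≤ dist x y := by
  obtain ⟨p, hp, -, h1, h2⟩ := hz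
  obtain ⟨q, hq, -, h3, h4⟩ := hw
  have hpm : p ∈ metricProj C x := hp ▸ Set.mem_singleton p
  have hqm : q ∈ metricProj C y := hq ▸ Set.mem_singleton q
  have hxp := hx.of_mem_metricProj hpm
  have hyq := hy.of_mem_metricProj hqm
  have V1 := genVer_dist_ge_of_mem_metricProj hn hC hpm hqm.1
  have V2 := genVer_dist_ge_of_mem_metricProj hn hC hqm hpm.1
  have M1 := genVer_dist_add_of_midpoint hn hxp rfl (by linarith : dist z p = dist x p)
    (by linarith) w
  have M2 := fun u => genVer_dist_add_of_midpoint hn hyq rfl (by linarith : dist w q = dist y q)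
    (by linarith) u
  have M3 := M2 p
  have M4 := M2 x
  have hα := genCos_pos dist_nonneg hxp
  have hβ := genCos_pos dist_nonneg hyq
  have P1 := mul_le_mul_of_nonneg_left V1 hβ.le
  have P2 := mul_le_mul_of_nonneg_left V2 hα.le
  -- What remains after the projection inequalities; it cancels by C = 1 - k V.
  have e : genVer k (dist x p) + genCos k (dist x p) * genVer k (dist y q) -
      genVer k (dist y q) - genCos k (dist y q) * genVer k (dist x p) = 0 := by
    simp only [genCos]
    ring
  apply dist_le_of_genVer_le
  rw [dist_comm z w]
  rw [dist_comm w x, dist_comm w p] at M1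
  rw [dist_comm q p, dist_comm y p] at P2
  linear_combination M1 - M4 + 2 * genCos k (dist x p) * M3 + 2 * P1 + 2 * P2 + 2 * e

/-! ### Position of points on geodesic lines -/

theorem eq_of_sqrt_mul_dist_eq_pi (hn : 1 ≤ n) (hk : 0 < k) {x y y' : ModelSpace k n}
    (h : √k * dist x y = Real.pi) (h' : √k * dist x y' = Real.pi) : y = y' := by
  obtain ⟨c, hc, h0, h1⟩ := exists_line hn x y
  obtain ⟨β, hβ⟩ := hc.genVer_dist_eq y'
  have e := hβ (dist x y)
  have e2 : dist y' x = dist x y := by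
    rw [dist_comm]
    exact mul_left_cancel₀ (Real.sqrt_pos.2 hk).ne' (h'.trans h.symm)
  rw [h1, h0, e2, genCos_pos_curv hk, genSin_pos_curv hk, h, Real.cos_pi, Real.sin_pi] at e
  refine (eq_of_genVer_dist_le_zero (e.trans ?_).le).symm
  ring

/-- A great circle is 2 D_k-periodic: `c u` and `c (u + 2 D_k)` are both antipodal to `c (u + D_k)`,
and antipodes are unique. The parameter t can thus be moved to within D_k of s. -/
theorem exists_param_near (hn : 1 ≤ n) {c : ℝ → ModelSpace k n}
    (hc : ∀ s t, ENNReal.ofReal |s - t| ≤ modelDiam k → dist (c s) (c t) = |s - t|) (s t : ℝ) :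
    ∃ t', c t' = c t ∧ dist (c s) (c t') = |s - t'| := by
  by_cases hk : 0 < k
  · have h0 : 0 < √k := Real.sqrt_pos.2 hk
    set D := Real.pi / √k with hD
    have hD0 : 0 < D := div_pos Real.pi_pos h0
    have hDk : √k * D = Real.pi := mul_div_cancel₀ _ h0.ne'
    have hc' : ∀ s t, |s - t| ≤ D → dist (c s) (c t) = |s - t| := fun s t h =>
      hc s t (ofReal_le_modelDiam.2 fun _ => hDk ▸ mul_le_mul_of_nonneg_left h h0.le)
    have hper : Function.Periodic c (2 * D) := by
      intro u
      have e1 : |u + D - (u + 2 * D)| = D := by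
        rw [show u + D - (u + 2 * D) = -D by ring, abs_neg, abs_of_pos hD0]
      have e2 : |u + D - u| = D := by rw [add_sub_cancel_left, abs_of_pos hD0]
      refine eq_of_sqrt_mul_dist_eq_pi hn hk (x := c (u + D)) ?_ ?_
      · rw [hc' _ _ e1.le, e1, hDk]
      · rw [hc' _ _ e2.le, e2, hDk]
    obtain ⟨t', ht', e⟩ := hper.exists_mem_Ico (by linarith) t (s - D)
    refine ⟨t', e.symm, hc' _ _ ?_⟩
    rw [abs_le]
    constructor <;> linarith [ht'.1, ht'.2]
  · exact ⟨t, rfl, hc s t (ofReal_le_modelDiam.2 fun h => absurd h hk)⟩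

/-- A point of a geodesic line through `a` and `p` at distance `r` from `p` which is farther from
`a` than from `p` lies beyond `p`. -/
theorem IsGeodesicLine.dist_eq_add (hn : 1 ≤ n) {L : Set (ModelSpace k n)}
    (hL : IsGeodesicLine L) {a p w : ModelSpace k n} (ha : a ∈ L) (hp : p ∈ L) (hw : w ∈ L)
    (hle : dist a p ≤ dist p w) (hk : 0 < k → √k * dist p w < Real.pi / 2)
    (hlt : dist w p < dist w a) : dist a w = dist a p + dist p w := by
  obtain ⟨c, rfl, hc⟩ := hL
  obtain ⟨p', rfl⟩ := hp
  obtain ⟨a₀, rfl⟩ := ha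
  obtain ⟨w₀, rfl⟩ := hw
  obtain ⟨a', ha', ea⟩ := exists_param_near hn hc p' a₀
  obtain ⟨w', hw', ew⟩ := exists_param_near hn hc p' w₀
  rw [← ha', ← hw'] at hlt
  rw [← hw'] at hk ⊢
  rw [← ha'] at hle ⊢
  rw [← hw'] at hle
  have htri : |a' - w'| ≤ |p' - a'| + |p' - w'| := by
    rw [abs_sub_comm p' a']
    exact abs_sub_le _ _ _
  -- Both a and w are less than D_k/2 from p, so all three distances are read off the parameters.
  -- The rest is order on the real line: w on the same side of p as a would be no farther from a
  -- than from p.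
  have e : dist (c a') (c w') = |a' - w'| := by
    refine hc _ _ (ofReal_le_modelDiam.2 fun h => ?_)
    have h1 := mul_le_mul_of_nonneg_left htri (Real.sqrt_nonneg k)
    have h2 := mul_le_mul_of_nonneg_left hle (Real.sqrt_nonneg k)
    have h3 := hk h
    rw [dist_comm (c a') (c p'), ea, ew] at h2
    rw [ew] at h3
    linarith
  rw [dist_comm (c w') (c p'), dist_comm (c w') (c a'), e, ew] at hlt
  rw [dist_comm (c a') (c p'), ea, ew] at hle
  rw [e, dist_comm (c a') (c p'), ea, ew]
  rcases abs_cases (p' - a') with h1 | h1 <;> rcases abs_cases (p' - w') with h2 | h2 <;>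
    rcases abs_cases (a' - w') with h3 | h3 <;> linarith

/-- By uniqueness of extensions, w lies on the line from a to w', so both points sit on one ray
beyond p. -/
theorem dist_eq_sub_of_extends (hn : 1 ≤ n) {a p w w' : ModelSpace k n} {r r' : ℝ} (hap : a ≠ p)
    (hr : 0 ≤ r) (hrr : r ≤ r') (hk : 0 < k → √k * (dist a p + r') < Real.pi)
    (hpw : dist p w = r) (haw : dist a w = dist a p + r)
    (hpw' : dist p w' = r') (haw' : dist a w' = dist a p + r') : dist w w' = r' - r := by
  obtain ⟨c, hc, h0, h1⟩ := exists_line hn a w'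
  rw [haw'] at h1
  have hd : 0 < dist a p := dist_pos.2 hap
  have hk' : 0 < k → √k * (dist a p + r') ≤ Real.pi := fun h => (hk h).le
  have hp : p = c (dist a p) := hc.eq_of_dist_add hd.le (hr.trans hrr) hk
    (by rw [h0, dist_comm]) (by rw [h1, hpw'])
  have hw : w = c (dist a p + r) := by
    refine eq_of_extends hn hd hr (fun h => ?_) rfl hpw haw ?_ ?_
    · exact (mul_le_mul_of_nonneg_left (by linarith) (Real.sqrt_nonneg k)).trans_lt (hk h)
    · have e := hc.dist_of_le hk' hd.le (by linarith : dist a p ≤ dist a p + r) (by linarith)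
      rwa [← hp, add_sub_cancel_left] at e
    · have e := hc.dist_of_le hk' le_rfl (by linarith : 0 ≤ dist a p + r) (by linarith)
      rwa [h0, sub_zero] at e
  rw [hw, ← h1, hc.dist_of_le hk' (by linarith) (by linarith) le_rfl]
  ring

end ModelSpace

/-! ### Gluings of two model spaces through a point -/

open ModelSpace

namespace PointGluing

theorem isGeodesicallyConvex_preimage {M X : Type*} [MetricSpace M] [MetricSpace X] {ι : M → X}
    (hι : Isometry ι) {B : Set X} (hB : IsGeodesicallyConvex B) :
    IsGeodesicallyConvex (ι ⁻¹' B) := by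
  rintro x hx y hy S ⟨c, l, ⟨hl, h0, h1, hc⟩, rfl⟩
  rw [← Set.image_subset_iff, ← Set.image_comp]
  refine hB _ hx _ hy _ ⟨ι ∘ c, l, ⟨hl, by simp [h0], by simp [h1], fun s hs t ht => ?_⟩, rfl⟩
  rw [Function.comp_apply, Function.comp_apply, hι.dist_eq, hc s hs t ht]

theorem metricProj_image {M X : Type*} [MetricSpace M] [MetricSpace X] {ι : M → X}
    (hι : Isometry ι) (C : Set M) (x : M) :
    metricProj (ι '' C) (ι x) = ι '' metricProj C x := by
  ext y
  simp only [metricProj, Metric.infDist_image hι, Set.mem_ofPred_eq, Set.mem_image]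
  constructor
  · rintro ⟨⟨z, hz, rfl⟩, h⟩
    exact ⟨z, ⟨hz, by rwa [hι.dist_eq] at h⟩, rfl⟩
  · rintro ⟨z, ⟨hz, h⟩, rfl⟩
    exact ⟨⟨z, hz, rfl⟩, by rwa [hι.dist_eq]⟩

variable {k k' : ℝ} {n m : ℕ} {X : Type*} [MetricSpace X]

/-- The maps `ι` and `ι'` present `X` as the gluing of two model spaces through the points `a`
and `b`. -/
structure IsGluing (ι : ModelSpace k n → X) (ι' : ModelSpace k' m → X) (a : ModelSpace k n)
    (b : ModelSpace k' m) : Prop where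
  left : Isometry ι
  right : Isometry ι'
  glued : ι a = ι' b
  dist_eq : ∀ x y, dist (ι x) (ι' y) = dist x a + dist y b
  cover : ∀ x, x ∈ Set.range ι ∨ x ∈ Set.range ι'

/-- The distance from `x` to some point of `B` is less than `D_k / 2` and `D_{k'} / 2`. -/
def IsNear₂ (k k' : ℝ) (B : Set X) (x : X) : Prop :=
  ∃ y ∈ B, (0 < k → √k * dist x y < Real.pi / 2) ∧ (0 < k' → √k' * dist x y < Real.pi / 2)

theorem IsNear₂.symm {B : Set X} {x : X} (h : IsNear₂ k k' B x) : IsNear₂ k' k B x :=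
  h.imp fun _ hy => ⟨hy.1, hy.2.2, hy.2.1⟩

theorem isNear₂_of_infEDist_lt {B : Set X} {x : X}
    (h : Metric.infEDist x B < min (modelDiam k) (modelDiam k') / 2) : IsNear₂ k k' B x := by
  obtain ⟨y, hy, hxy⟩ := Metric.infEDist_lt_iff.1 h
  rw [edist_dist] at hxy
  exact ⟨y, hy,
    ofReal_lt_modelDiam_div_two.1 (hxy.trans_le (ENNReal.div_le_div_right (min_le_left _ _) _)),
    ofReal_lt_modelDiam_div_two.1 (hxy.trans_le (ENNReal.div_le_div_right (min_le_right _ _) _))⟩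

/-- The conditions on the reflection when `θ` belongs to `B`. -/
def IsReflectionOfMem (ι : ModelSpace k n → X) (ι' : ModelSpace k' m → X) (B : Set X)
    (x z : X) : Prop :=
  (x ∈ Set.range ι → ReflectInside ι B x z) ∧ (x ∈ Set.range ι' → ReflectInside ι' B x z)

/-- The conditions on the reflection when `θ` does not belong to `B`, which is contained in the
first model space. -/
def IsReflectionOfNotMem (ι : ModelSpace k n → X) (ι' : ModelSpace k' m → X)
    (a : ModelSpace k n) (B : Set X) (x z : X) : Prop :=
  (x ∈ Set.range ι → ReflectInside ι B x z) ∧ (x ∈ Set.range ι' → ReflectAcross ι a B x z)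

theorem reflectInside_iff {ι : ModelSpace k n → X} (hι : Isometry ι) {B : Set X}
    {u : ModelSpace k n} {z : X} :
    ReflectInside ι B (ι u) z ↔ ∃ w, ι w = z ∧ ModelSpace.IsReflection (ι ⁻¹' B) u w := by
  constructor
  · rintro ⟨u', w, hu, hw, h⟩
    obtain rfl := hι.injective hu
    exact ⟨w, hw, h⟩
  · rintro ⟨w, hw, h⟩
    exact ⟨u, w, rfl, hw, h⟩

theorem reflectInside_existsUnique (hn : 1 ≤ n) {ι : ModelSpace k n → X} (hι : Isometry ι)
    {B : Set X} (hcl : IsClosed B) (hB : IsGeodesicallyConvex B) {u : ModelSpace k n}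
    (hu : IsNear (ι ⁻¹' B) u) : ∃! z, ReflectInside ι B (ι u) z := by
  obtain ⟨w, hw, huniq⟩ := hu.existsUnique_isReflection hn (hcl.preimage hι.continuous)
    (isGeodesicallyConvex_preimage hι hB)
  refine ⟨ι w, (reflectInside_iff hι).2 ⟨w, rfl, hw⟩, fun z hz => ?_⟩
  obtain ⟨w', rfl, hw'⟩ := (reflectInside_iff hι).1 hz
  rw [huniq w' hw']

theorem reflectInside_dist_le (hn : 1 ≤ n) {ι : ModelSpace k n → X} (hι : Isometry ι)
    {B : Set X} (hB : IsGeodesicallyConvex B) {u v : ModelSpace k n}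
    (hu : IsNear (ι ⁻¹' B) u) (hv : IsNear (ι ⁻¹' B) v) {z w : X}
    (hz : ReflectInside ι B (ι u) z) (hw : ReflectInside ι B (ι v) w) :
    dist z w ≤ dist (ι u) (ι v) := by
  obtain ⟨z', rfl, hz'⟩ := (reflectInside_iff hι).1 hz
  obtain ⟨w', rfl, hw'⟩ := (reflectInside_iff hι).1 hw
  rw [hι.dist_eq, hι.dist_eq]
  exact hz'.dist_le hn (isGeodesicallyConvex_preimage hι hB) hu hv hw'

theorem reflectInside_eq_self {ι : ModelSpace k n → X} (hι : Isometry ι) {B : Set X}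
    {u : ModelSpace k n} (hu : ι u ∈ B) {z : X} (hz : ReflectInside ι B (ι u) z) : z = ι u := by
  obtain ⟨w, rfl, hw⟩ := (reflectInside_iff hι).1 hz
  rw [hw.eq_self hu]

namespace IsGluing

variable {ι : ModelSpace k n → X} {ι' : ModelSpace k' m → X} {a : ModelSpace k n}
  {b : ModelSpace k' m} {B : Set X}

/-- Lets every statement about one side of the gluing serve for the other. -/
theorem symm (h : IsGluing ι ι' a b) : IsGluing ι' ι b a where
  left := h.right
  right := h.left
  glued := h.glued.symm
  dist_eq x y := by rw [dist_comm, h.dist_eq, add_comm]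
  cover x := (h.cover x).symm

theorem eq_of_eq (h : IsGluing ι ι' a b) {u : ModelSpace k n} {v : ModelSpace k' m}
    (huv : ι u = ι' v) : u = a := by
  have := h.dist_eq u v
  rw [huv, dist_self] at this
  exact dist_le_zero.1 (by linarith [dist_nonneg (x := u) (y := a), dist_nonneg (x := v) (y := b)])

theorem isGeodesic_concat (h : IsGluing ι ι' a b) {u : ModelSpace k n} {v : ModelSpace k' m}
    {c : ℝ → ModelSpace k n} {c' : ℝ → ModelSpace k' m} {l l' : ℝ} (hc : IsGeodesic c l u a)
    (hc' : IsGeodesic c' l' b v) :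
    IsGeodesic (fun t => if t ≤ l then ι (c t) else ι' (c' (t - l))) (l + l') (ι u) (ι' v) := by
  obtain ⟨hl, h0, h1, hd⟩ := hc
  obtain ⟨hl', h0', h1', hd'⟩ := hc'
  have mixed : ∀ s t, 0 ≤ s → s ≤ l → l < t → t ≤ l + l' →
      dist (ι (c s)) (ι' (c' (t - l))) = t - s := by
    intro s t hs hsl hlt htl
    rw [h.dist_eq, ← h1, ← h0', hd s ⟨hs, hsl⟩ l ⟨hl, le_rfl⟩,
      hd' _ ⟨by linarith, by linarith⟩ 0 ⟨le_rfl, hl'⟩, abs_sub_comm,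
      abs_of_nonneg (by linarith), sub_zero, abs_of_nonneg (by linarith)]
    ring
  refine ⟨by linarith, by simp [hl, h0], ?_, ?_⟩
  -- If l' = 0, the endpoint falls in the first branch; then v = b, which is glued to a.
  · rcases hl'.eq_or_lt with h2 | h2
    · simp only [← h2, add_zero, le_refl, if_true]
      rw [h1, h.glued, ← h0', ← h1', ← h2]
    · simp [h2, h1']
  · rintro s ⟨hs, hsl⟩ t ⟨ht, htl⟩
    simp only
    split_ifs with h2 h3 h3
    · rw [h.left.dist_eq, hd s ⟨hs, h2⟩ t ⟨ht, h3⟩]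
    · rw [mixed s t hs h2 (by linarith) htl, abs_sub_comm, abs_of_nonneg (by linarith)]
    · rw [dist_comm, mixed t s ht h3 (by linarith) hsl, abs_of_nonneg (by linarith)]
    · rw [h.right.dist_eq, hd' _ ⟨by linarith, by linarith⟩ _ ⟨by linarith, by linarith⟩,
        sub_sub_sub_cancel_right]

/-- Points of B on both sides would be joined by a geodesic through θ, the concatenation of segments
to and from θ. -/
theorem subset_or_subset (h : IsGluing ι ι' a b) (hn : 1 ≤ n) (hm : 1 ≤ m)
    (hB : IsGeodesicallyConvex B) (ha : ι a ∉ B) : B ⊆ Set.range ι ∨ B ⊆ Set.range ι' := by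
  by_contra! hcon
  obtain ⟨⟨x, hxB, hx⟩, ⟨y, hyB, hy⟩⟩ := And.imp Set.not_subset.1 Set.not_subset.1 hcon
  obtain ⟨v, rfl⟩ := (h.cover x).resolve_left hx
  obtain ⟨u, rfl⟩ := (h.cover y).resolve_right hy
  obtain ⟨c, hc, h0, h1⟩ := exists_line hn u a
  obtain ⟨c', hc', h0', h1'⟩ := exists_line hm b v
  refine ha (hB _ hyB _ hxB _
    ⟨_, _, h.isGeodesic_concat (hc.isGeodesic h0 h1) (hc'.isGeodesic h0' h1'), rfl⟩
    ⟨dist u a, ⟨dist_nonneg, le_add_of_nonneg_right dist_nonneg⟩, ?_⟩)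
  simp [h1]

theorem isNear (h : IsGluing ι ι' a b) (hB : ι a ∈ B ∨ B ⊆ Set.range ι) {u : ModelSpace k n}
    (hu : IsNear₂ k k' B (ι u)) : IsNear (ι ⁻¹' B) u := by
  obtain ⟨y, hy, hk, -⟩ := hu
  rcases hB with ha | hsub
  · rcases h.cover y with ⟨v, rfl⟩ | ⟨v, rfl⟩
    · exact ⟨v, hy, by rwa [h.left.dist_eq] at hk⟩
    -- A witness on the other side is replaced by θ, which is no farther away.
    · refine ⟨a, ha, fun h0 => lt_of_le_of_lt ?_ (hk h0)⟩
      rw [h.dist_eq]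
      exact mul_le_mul_of_nonneg_left (le_add_of_nonneg_right dist_nonneg) (Real.sqrt_nonneg k)
  · obtain ⟨v, rfl⟩ := hsub hy
    exact ⟨v, hy, by rwa [h.left.dist_eq] at hk⟩

/-! ### Reflection when θ belongs to B -/

theorem reflectInside_of_mem (h : IsGluing ι ι' a b) (hm : 1 ≤ m) (hcl : IsClosed B)
    (hB : IsGeodesicallyConvex B) (ha : ι a ∈ B) {u : ModelSpace k n}
    (hu : IsNear₂ k k' B (ι u)) {z : X} (hz : ReflectInside ι B (ι u) z)
    (hmem : ι u ∈ Set.range ι') : ReflectInside ι' B (ι u) z := by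
  obtain ⟨v, hv⟩ := hmem
  -- The two sides meet only at θ, which lies in B and is fixed by both reflections.
  obtain rfl := h.eq_of_eq hv.symm
  have hb : ι' v ∈ B := hv ▸ ha
  obtain ⟨w, hw, -⟩ := reflectInside_existsUnique hm h.right hcl hB
    (h.symm.isNear (.inl (h.glued ▸ ha)) (u := v) (hv ▸ hu.symm))
  have e := reflectInside_eq_self h.right hb hw
  rw [reflectInside_eq_self h.left ha hz, ← hv]
  rwa [e] at hw

theorem existsUnique_of_mem (h : IsGluing ι ι' a b) (hn : 1 ≤ n) (hm : 1 ≤ m) (hcl : IsClosed B)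
    (hB : IsGeodesicallyConvex B) (ha : ι a ∈ B) {x : X} (hx : IsNear₂ k k' B x) :
    ∃! z, IsReflectionOfMem ι ι' B x z := by
  have hb : ι' b ∈ B := h.glued ▸ ha
  rcases h.cover x with ⟨u, rfl⟩ | ⟨u, rfl⟩
  · obtain ⟨z, hz, huniq⟩ := reflectInside_existsUnique hn h.left hcl hB (h.isNear (.inl ha) hx)
    exact ⟨z, ⟨fun _ => hz, h.reflectInside_of_mem hm hcl hB ha hx hz⟩,
      fun z' hz' => huniq z' (hz'.1 ⟨u, rfl⟩)⟩
  · obtain ⟨z, hz, huniq⟩ :=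
      reflectInside_existsUnique hm h.right hcl hB (h.symm.isNear (.inl hb) hx.symm)
    exact ⟨z, ⟨h.symm.reflectInside_of_mem hn hcl hB hb hx.symm hz, fun _ => hz⟩,
      fun z' hz' => huniq z' (hz'.2 ⟨u, rfl⟩)⟩

theorem dist_le_of_mem_of_reflectInside (h : IsGluing ι ι' a b) (hn : 1 ≤ n) (hm : 1 ≤ m)
    (hB : IsGeodesicallyConvex B) (ha : ι a ∈ B) {u : ModelSpace k n} {v : ModelSpace k' m}
    (hx : IsNear (ι ⁻¹' B) u) (hy : IsNear (ι' ⁻¹' B) v) {z w : X}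
    (hz : ReflectInside ι B (ι u) z) (hw : ReflectInside ι' B (ι' v) w)
    (hθ : ReflectInside ι B (ι a) (ι a)) (hθ' : ReflectInside ι' B (ι' b) (ι' b)) :
    dist z w ≤ dist (ι u) (ι' v) := by
  have near_of_mem : ∀ {k₀ : ℝ} {n₀ : ℕ} {C : Set (ModelSpace k₀ n₀)} {p}, p ∈ C → IsNear C p :=
    fun hp => ⟨_, hp, fun _ => by simp [Real.pi_pos]⟩
  have h1 := reflectInside_dist_le hn h.left hB hx (near_of_mem (p := a) ha) hz hθ
  have h2 := reflectInside_dist_le hm h.right hB (near_of_mem (p := b) (h.glued ▸ ha : ι' b ∈ B))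
    hy hθ' hw
  rw [h.left.dist_eq] at h1
  rw [h.right.dist_eq, ← h.glued, dist_comm b v] at h2
  rw [h.dist_eq]
  exact (dist_triangle _ _ _).trans (add_le_add h1 h2)

theorem dist_le_of_mem (h : IsGluing ι ι' a b) (hn : 1 ≤ n) (hm : 1 ≤ m) (hcl : IsClosed B)
    (hB : IsGeodesicallyConvex B) (ha : ι a ∈ B) {x y z w : X} (hx : IsNear₂ k k' B x)
    (hy : IsNear₂ k k' B y) (hz : IsReflectionOfMem ι ι' B x z)
    (hw : IsReflectionOfMem ι ι' B y w) : dist z w ≤ dist x y := by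
  have hb : ι' b ∈ B := h.glued ▸ ha
  have hθn : IsNear₂ k k' B (ι a) :=
    ⟨ι a, ha, fun _ => by simp [Real.pi_pos], fun _ => by simp [Real.pi_pos]⟩
  obtain ⟨t, ht, -⟩ := h.existsUnique_of_mem hn hm hcl hB ha hθn
  have ht1 := ht.1 ⟨a, rfl⟩
  have ht2 := ht.2 ⟨b, h.glued.symm⟩
  obtain rfl := reflectInside_eq_self h.left ha ht1
  have ht3 : ReflectInside ι' B (ι' b) (ι' b) := h.glued ▸ ht2
  rcases h.cover x with ⟨u, rfl⟩ | ⟨u, rfl⟩ <;> rcases h.cover y with ⟨v, rfl⟩ | ⟨v, rfl⟩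
  · exact reflectInside_dist_le hn h.left hB (h.isNear (.inl ha) hx) (h.isNear (.inl ha) hy)
      (hz.1 ⟨u, rfl⟩) (hw.1 ⟨v, rfl⟩)
  · exact h.dist_le_of_mem_of_reflectInside hn hm hB ha (h.isNear (.inl ha) hx)
      (h.symm.isNear (.inl hb) hy.symm) (hz.1 ⟨u, rfl⟩) (hw.2 ⟨v, rfl⟩) ht1 ht3
  · exact h.symm.dist_le_of_mem_of_reflectInside hm hn hB hb (h.symm.isNear (.inl hb) hx.symm)
      (h.isNear (.inl ha) hy) (hz.2 ⟨u, rfl⟩) (hw.1 ⟨v, rfl⟩) ht3 ht1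
  · exact reflectInside_dist_le hm h.right hB (h.symm.isNear (.inl hb) hx.symm)
      (h.symm.isNear (.inl hb) hy.symm) (hz.2 ⟨u, rfl⟩) (hw.2 ⟨v, rfl⟩)

/-! ### Reflection when θ does not belong to B -/

theorem metricProj_eq_iff (hι : Isometry ι) (hsub : B ⊆ Set.range ι) {p : ModelSpace k n} :
    metricProj B (ι a) = {ι p} ↔ metricProj (ι ⁻¹' B) a = {p} := by
  conv_lhs => rw [← Set.image_preimage_eq_of_subset hsub, metricProj_image hι,
    ← Set.image_singleton]
  exact hι.injective.image_injective.eq_iff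

/-- The path from the far point to any q in B passes through θ, and p is no farther from θ than q.
Hence the radius d(x, p) of the reflection across is below D_k/2. -/
theorem across_radius (h : IsGluing ι ι' a b) (hsub : B ⊆ Set.range ι) {v : ModelSpace k' m}
    (hv : IsNear₂ k k' B (ι' v)) {p : ModelSpace k n} (hp : p ∈ metricProj (ι ⁻¹' B) a)
    (hk : 0 < k) : √k * (dist a p + dist v b) < Real.pi / 2 := by
  obtain ⟨y, hy, hyk, -⟩ := hv
  obtain ⟨q, rfl⟩ := hsub hy
  refine lt_of_le_of_lt (mul_le_mul_of_nonneg_left ?_ (Real.sqrt_nonneg k)) (hyk hk)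
  rw [dist_comm (ι' v), h.dist_eq, dist_comm q a]
  gcongr
  exact dist_le_of_mem_metricProj hp hy

theorem isNear_of_isNear₂ (h : IsGluing ι ι' a b) (hsub : B ⊆ Set.range ι)
    {v : ModelSpace k' m} (hv : IsNear₂ k k' B (ι' v)) : IsNear₂ k k' B (ι a) := by
  obtain ⟨y, hy, hyk, hyk'⟩ := hv
  obtain ⟨q, rfl⟩ := hsub hy
  have hle : dist (ι a) (ι q) ≤ dist (ι' v) (ι q) := by
    rw [h.left.dist_eq, dist_comm (ι' v), h.dist_eq, dist_comm a q]
    exact le_add_of_nonneg_right dist_nonneg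
  exact ⟨_, hy,
    fun hk => (mul_le_mul_of_nonneg_left hle (Real.sqrt_nonneg k)).trans_lt (hyk hk),
    fun hk => (mul_le_mul_of_nonneg_left hle (Real.sqrt_nonneg k')).trans_lt (hyk' hk)⟩

theorem dist_across (h : IsGluing ι ι' a b) (p : ModelSpace k n) (v : ModelSpace k' m) :
    dist (ι' v) (ι p) = dist a p + dist v b := by
  rw [dist_comm, h.dist_eq, dist_comm p a]

/-- Turns the line and inequality conditions into two distances that fix the point: it lies beyond p
on the extension of [a, p]. -/
theorem reflectAcross_spec (h : IsGluing ι ι' a b) (hn : 1 ≤ n) (hsub : B ⊆ Set.range ι)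
    {v : ModelSpace k' m} (hv : IsNear₂ k k' B (ι' v)) {p : ModelSpace k n}
    (hp : metricProj (ι ⁻¹' B) a = {p}) {z : X} (hz : ReflectAcross ι a B (ι' v) z) :
    ∃ w, ι w = z ∧ dist p w = dist a p + dist v b ∧
      dist a w = dist a p + (dist a p + dist v b) := by
  obtain ⟨p', w, hp', rfl, ⟨S, L, ⟨c, l, ⟨hl, h0, h1, -⟩, rfl⟩, hL, hSL, hwL⟩, hd, hgt⟩ := hz
  obtain rfl : p = p' := Set.singleton_injective
    (hp.symm.trans ((metricProj_eq_iff h.left hsub).1 hp'))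
  have hpm : p ∈ metricProj (ι ⁻¹' B) a := hp ▸ Set.mem_singleton p
  rw [h.left.dist_eq, h.dist_across] at hd
  rw [gt_iff_lt, h.left.dist_eq, h.left.dist_eq] at hgt
  have haL : a ∈ L := hSL ⟨0, ⟨le_rfl, hl⟩, h0⟩
  have hpL : p ∈ L := hSL ⟨l, ⟨hl, le_rfl⟩, h1⟩
  refine ⟨w, rfl, hd, ?_⟩
  rw [hL.dist_eq_add hn haL hpL hwL (by rw [hd]; exact le_add_of_nonneg_right dist_nonneg)
    (by rw [hd]; exact h.across_radius hsub hv hpm) hgt, hd]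

/-- Both images lie on the extension of [a, p] beyond p, at distances d(a, p) + d(u, b) and d(a, p)
+ d(v, b) from p. The whole segment from a is shorter than D_k, since it is at most twice the radius
bounded in `across_radius`. -/
theorem reflectAcross_dist_eq (h : IsGluing ι ι' a b) (hn : 1 ≤ n) (hcl : IsClosed B)
    (hB : IsGeodesicallyConvex B) (hsub : B ⊆ Set.range ι) (ha : ι a ∉ B)
    {u v : ModelSpace k' m} (hu : IsNear₂ k k' B (ι' u)) (hv : IsNear₂ k k' B (ι' v)) {z w : X}
    (hz : ReflectAcross ι a B (ι' u) z) (hw : ReflectAcross ι a B (ι' v) w) :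
    dist z w = |dist v b - dist u b| := by
  wlog huv : dist u b ≤ dist v b generalizing u v z w
  · rw [dist_comm, this hv hu hw hz (le_of_not_ge huv), abs_sub_comm]
  obtain ⟨p, hp⟩ := (h.isNear (.inr hsub) (h.isNear_of_isNear₂ hsub hu)).exists_metricProj_eq hn
    (hcl.preimage h.left.continuous) (isGeodesicallyConvex_preimage h.left hB)
  have hpm : p ∈ metricProj (ι ⁻¹' B) a := hp ▸ Set.mem_singleton p
  obtain ⟨z, rfl, hz1, hz2⟩ := h.reflectAcross_spec hn hsub hu hp hz
  obtain ⟨w, rfl, hw1, hw2⟩ := h.reflectAcross_spec hn hsub hv hp hw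
  have hap : a ≠ p := fun e => ha (e ▸ hpm.1 : a ∈ ι ⁻¹' B)
  rw [h.left.dist_eq, dist_eq_sub_of_extends hn hap
    (add_nonneg dist_nonneg dist_nonneg) (by linarith) (fun hk => ?_) hz1 hz2 hw1 hw2,
    abs_of_nonneg (sub_nonneg.2 huv), add_sub_add_left_eq_sub]
  have h1 := h.across_radius hsub hv hpm hk
  have h2 : √k * dist a p ≤ √k * (dist a p + dist v b) :=
    mul_le_mul_of_nonneg_left (le_add_of_nonneg_right dist_nonneg) (Real.sqrt_nonneg k)
  rw [mul_add]
  linarith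

theorem reflectAcross_existsUnique (h : IsGluing ι ι' a b) (hn : 1 ≤ n) (hcl : IsClosed B)
    (hB : IsGeodesicallyConvex B) (hsub : B ⊆ Set.range ι) (ha : ι a ∉ B)
    {v : ModelSpace k' m} (hv : IsNear₂ k k' B (ι' v)) :
    ∃! z, ReflectAcross ι a B (ι' v) z := by
  obtain ⟨p, hp⟩ := (h.isNear (.inr hsub) (h.isNear_of_isNear₂ hsub hv)).exists_metricProj_eq hn
    (hcl.preimage h.left.continuous) (isGeodesicallyConvex_preimage h.left hB)
  have hpm : p ∈ metricProj (ι ⁻¹' B) a := hp ▸ Set.mem_singleton p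
  have hap : a ≠ p := fun e => ha (e ▸ hpm.1 : a ∈ ι ⁻¹' B)
  obtain ⟨w, hw, hw1, hw2⟩ := exists_line_extending hn a p (r := dist a p + dist v b)
    (by positivity) fun hk => by
      have h1 := h.across_radius hsub hv hpm hk
      have h2 : √k * dist a p ≤ √k * (dist a p + dist v b) :=
        mul_le_mul_of_nonneg_left (le_add_of_nonneg_right dist_nonneg) (Real.sqrt_nonneg k)
      rw [mul_add]
      linarith
  have hr : ReflectAcross ι a B (ι' v) (ι w) := by
    refine ⟨p, w, (metricProj_eq_iff h.left hsub).2 hp, rfl, hw, ?_, ?_⟩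
    · rw [h.left.dist_eq, h.dist_across, hw1]
    · rw [h.left.dist_eq, h.left.dist_eq, dist_comm w a, dist_comm w p, hw1, hw2]
      exact lt_add_of_pos_left _ (dist_pos.2 hap)
  refine ⟨ι w, hr, fun z hz => ?_⟩
  -- Uniqueness is the distance formula for two reflections of the same point.
  rw [← dist_eq_zero, h.reflectAcross_dist_eq hn hcl hB hsub ha hv hv hz hr, sub_self, abs_zero]

/-- Compatibility of the two clauses at θ: there the radius is d(a, p), and d(z, a) = 2 d(z, p) >
d(z, p). -/
theorem reflectAcross_of_reflectInside (hι : Isometry ι) (hsub : B ⊆ Set.range ι)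
    (ha : ι a ∉ B) {z : X} (hz : ReflectInside ι B (ι a) z) : ReflectAcross ι a B (ι a) z := by
  obtain ⟨w, rfl, p, hp, hline, h1, h2⟩ := (reflectInside_iff hι).1 hz
  have hpm : p ∈ metricProj (ι ⁻¹' B) a := hp ▸ Set.mem_singleton p
  have hap : 0 < dist a p := dist_pos.2 fun e => ha (e ▸ hpm.1 : a ∈ ι ⁻¹' B)
  refine ⟨p, w, (metricProj_eq_iff hι hsub).2 hp, rfl, hline, ?_, ?_⟩
  · rw [hι.dist_eq, hι.dist_eq, dist_comm]
    linarith
  · rw [hι.dist_eq, hι.dist_eq, dist_comm w a]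
    linarith

theorem existsUnique_of_notMem (h : IsGluing ι ι' a b) (hn : 1 ≤ n) (hcl : IsClosed B)
    (hB : IsGeodesicallyConvex B) (hsub : B ⊆ Set.range ι) (ha : ι a ∉ B) {x : X}
    (hx : IsNear₂ k k' B x) : ∃! z, IsReflectionOfNotMem ι ι' a B x z := by
  by_cases hmem : x ∈ Set.range ι
  · obtain ⟨u, rfl⟩ := hmem
    obtain ⟨z, hz, huniq⟩ :=
      reflectInside_existsUnique hn h.left hcl hB (h.isNear (.inr hsub) hx)
    refine ⟨z, ⟨fun _ => hz, ?_⟩, fun z' hz' => huniq z' (hz'.1 ⟨u, rfl⟩)⟩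
    rintro ⟨v, hv⟩
    obtain rfl := h.eq_of_eq hv.symm
    exact reflectAcross_of_reflectInside h.left hsub ha hz
  · obtain ⟨v, rfl⟩ := (h.cover x).resolve_left hmem
    obtain ⟨z, hz, huniq⟩ := h.reflectAcross_existsUnique hn hcl hB hsub ha hx
    exact ⟨z, ⟨fun h' => absurd h' hmem, fun _ => hz⟩, fun z' hz' => huniq z' (hz'.2 ⟨v, rfl⟩)⟩

/-- For mixed pairs the triangle inequality passes through the image t of θ: the inside reflection
is nonexpansive between u and θ, and d(t, Rv) is exactly d(v, b). For two far points the bound is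
the reverse triangle inequality. -/
theorem dist_le_of_notMem (h : IsGluing ι ι' a b) (hn : 1 ≤ n) (hcl : IsClosed B)
    (hB : IsGeodesicallyConvex B) (hsub : B ⊆ Set.range ι) (ha : ι a ∉ B) {x y z w : X}
    (hx : IsNear₂ k k' B x) (hy : IsNear₂ k k' B y) (hz : IsReflectionOfNotMem ι ι' a B x z)
    (hw : IsReflectionOfNotMem ι ι' a B y w) : dist z w ≤ dist x y := by
  have mixed : ∀ {u : ModelSpace k n} {v : ModelSpace k' m} {z w : X},
      IsNear₂ k k' B (ι u) → IsNear₂ k k' B (ι' v) → ReflectInside ι B (ι u) z →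
      ReflectAcross ι a B (ι' v) w → dist z w ≤ dist (ι u) (ι' v) := by
    intro u v z w hu hv hz hw
    have hθ := h.isNear_of_isNear₂ hsub hv
    obtain ⟨t, ht, -⟩ := h.existsUnique_of_notMem hn hcl hB hsub ha hθ
    have h1 := reflectInside_dist_le hn h.left hB (h.isNear (.inr hsub) hu)
      (h.isNear (.inr hsub) hθ) hz (ht.1 ⟨a, rfl⟩)
    have ht2 := ht.2 ⟨b, h.glued.symm⟩
    rw [h.glued] at ht2 hθ
    have h2 := h.reflectAcross_dist_eq hn hcl hB hsub ha hθ hv ht2 hw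
    rw [dist_self, sub_zero, abs_of_nonneg dist_nonneg] at h2
    rw [h.left.dist_eq] at h1
    rw [h.dist_eq]
    exact (dist_triangle z t w).trans (add_le_add h1 h2.le)
  rcases h.cover x with ⟨u, rfl⟩ | ⟨u, rfl⟩ <;> rcases h.cover y with ⟨v, rfl⟩ | ⟨v, rfl⟩
  · exact reflectInside_dist_le hn h.left hB (h.isNear (.inr hsub) hx) (h.isNear (.inr hsub) hy)
      (hz.1 ⟨u, rfl⟩) (hw.1 ⟨v, rfl⟩)
  · exact mixed hx hy (hz.1 ⟨u, rfl⟩) (hw.2 ⟨v, rfl⟩)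
  · rw [dist_comm z, dist_comm (ι' u)]
    exact mixed hy hx (hw.1 ⟨v, rfl⟩) (hz.2 ⟨u, rfl⟩)
  · rw [h.reflectAcross_dist_eq hn hcl hB hsub ha hx hy (hz.2 ⟨u, rfl⟩) (hw.2 ⟨v, rfl⟩),
      h.right.dist_eq, abs_sub_comm]
    exact abs_dist_sub_le _ _ _

theorem not_subset_right (h : IsGluing ι ι' a b) (hne : B.Nonempty) (ha : ι a ∉ B)
    (hsub : B ⊆ Set.range ι) : ¬B ⊆ Set.range ι' := by
  intro hsub'
  obtain ⟨x, hx⟩ := hne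
  obtain ⟨u, rfl⟩ := hsub hx
  obtain ⟨v, hv⟩ := hsub' hx
  exact ha (h.eq_of_eq hv.symm ▸ hx)

end IsGluing

theorem isGluing (a : ModelSpace k n) (b : ModelSpace k' m) :
    IsGluing (inL a b) (inR a b) a b where
  left := Metric.toGlueL_isometry _ _
  right := Metric.toGlueR_isometry _ _
  glued := congrFun (Metric.toGlue_commute (isometry_point a) (isometry_point b)) ()
  dist_eq x y := by
    -- The glued distance is an infimum over the gluing set, here one point, plus a gap parameter,
    -- here 0.
    change (⨅ _ : Unit, dist x a + dist y b) + 0 = _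
    simp
  cover x := by
    obtain ⟨y, rfl⟩ := Quotient.exists_rep x
    rcases y with y | y
    · exact .inl ⟨y, rfl⟩
    · exact .inr ⟨y, rfl⟩

/-- Exactly one of the three sets of conditions in the definition of the reflection applies. -/
theorem isReflection_cases (hn : 1 ≤ n) (hm : 1 ≤ m) (a : ModelSpace k n) (b : ModelSpace k' m)
    {B : Set (PointGluing a b)} (hne : B.Nonempty) (hB : IsGeodesicallyConvex B) :
    (inL a b a ∈ B ∧ ∀ x z, IsReflection a b B x z ↔
      IsReflectionOfMem (inL a b) (inR a b) B x z) ∨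
    (inL a b a ∉ B ∧ B ⊆ Set.range (inL a b) ∧ ∀ x z, IsReflection a b B x z ↔
      IsReflectionOfNotMem (inL a b) (inR a b) a B x z) ∨
    (inR a b b ∉ B ∧ B ⊆ Set.range (inR a b) ∧ ∀ x z, IsReflection a b B x z ↔
      IsReflectionOfNotMem (inR a b) (inL a b) b B x z) := by
  have h := isGluing a b
  by_cases ha : inL a b a ∈ B
  · exact .inl ⟨ha, fun x z => by simp [IsReflection, IsReflectionOfMem, theta, ha]⟩
  right
  have hb : inR a b b ∉ B := h.glued ▸ ha
  rcases h.subset_or_subset hn hm hB ha with hsub | hsub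
  · have hns := h.not_subset_right hne ha hsub
    exact .inl ⟨ha, hsub,
      fun x z => by simp [IsReflection, IsReflectionOfNotMem, theta, ha, hsub, hns]⟩
  · have hns := h.symm.not_subset_right hne hb hsub
    exact .inr ⟨hb, hsub,
      fun x z => by simp [IsReflection, IsReflectionOfNotMem, theta, ha, hsub, hns]⟩

end PointGluing

theorem mainTheorem2 (k k' : ℝ) (hkk' : k ≠ k') (n m : ℕ) (hn : 1 ≤ n) (hm : 1 ≤ m)
    (a : ModelSpace k n) (b : ModelSpace k' m)
    (B : Set (PointGluing a b)) (hB_nonempty : B.Nonempty) (hB_closed : IsClosed B)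
    (hB_convex : IsGeodesicallyConvex B) :
    (PointGluing.theta a b ∉ B →
      Xor (B ⊂ Set.range (PointGluing.inL a b)) (B ⊂ Set.range (PointGluing.inR a b))) ∧
    (∀ x : PointGluing a b, Metric.infEDist x B < min (modelDiam k) (modelDiam k') / 2 →
      ∃! z : PointGluing a b, PointGluing.IsReflection a b B x z) ∧
    (∀ R : PointGluing a b → PointGluing a b,
      (∀ x, Metric.infEDist x B < min (modelDiam k) (modelDiam k') / 2 →
        PointGluing.IsReflection a b B x (R x)) →
      ∀ x y, Metric.infEDist x B < min (modelDiam k) (modelDiam k') / 2 →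
        Metric.infEDist y B < min (modelDiam k) (modelDiam k') / 2 →
        dist (R x) (R y) ≤ dist x y) := by
  have h := PointGluing.isGluing a b
  refine ⟨fun hθ => ?_, ?_⟩
  · have ha : PointGluing.inL a b a ∉ B := hθ
    have hb : PointGluing.inR a b b ∉ B := h.glued ▸ ha
    rcases h.subset_or_subset hn hm hB_convex ha with hsub | hsub
    · exact .inl ⟨⟨hsub, fun h' => ha (h' ⟨a, rfl⟩)⟩,
        fun h' => h.not_subset_right hB_nonempty ha hsub h'.1⟩
    · exact .inr ⟨⟨hsub, fun h' => hb (h' ⟨b, rfl⟩)⟩,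
        fun h' => h.symm.not_subset_right hB_nonempty hb hsub h'.1⟩
  · rcases PointGluing.isReflection_cases hn hm a b hB_nonempty hB_convex with
      ⟨ha, hR⟩ | ⟨ha, hsub, hR⟩ | ⟨hb, hsub, hR⟩ <;> simp only [hR]
    · exact ⟨fun x hx => h.existsUnique_of_mem hn hm hB_closed hB_convex ha
        (PointGluing.isNear₂_of_infEDist_lt hx), fun R hRx x y hx hy =>
        h.dist_le_of_mem hn hm hB_closed hB_convex ha (PointGluing.isNear₂_of_infEDist_lt hx)
          (PointGluing.isNear₂_of_infEDist_lt hy) (hRx x hx) (hRx y hy)⟩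
    · exact ⟨fun x hx => h.existsUnique_of_notMem hn hB_closed hB_convex hsub ha
        (PointGluing.isNear₂_of_infEDist_lt hx), fun R hRx x y hx hy =>
        h.dist_le_of_notMem hn hB_closed hB_convex hsub ha (PointGluing.isNear₂_of_infEDist_lt hx)
          (PointGluing.isNear₂_of_infEDist_lt hy) (hRx x hx) (hRx y hy)⟩
    · exact ⟨fun x hx => h.symm.existsUnique_of_notMem hm hB_closed hB_convex hsub hb
        (PointGluing.isNear₂_of_infEDist_lt hx).symm, fun R hRx x y hx hy =>
        h.symm.dist_le_of_notMem hm hB_closed hB_convex hsub hb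
          (PointGluing.isNear₂_of_infEDist_lt hx).symm
          (PointGluing.isNear₂_of_infEDist_lt hy).symm (hRx x hx) (hRx y hy)⟩
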